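/- **Setting.** Let $q\in\mathbb C$, $0<|q|<1$, $t\in\mathbb C\setminus\{0\}$, and let $b_1,b_2,b_3,b_4,b_6\in\mathbb C$ with $b_1b_2b_3b_4=1$ and $b_6\ne0$. With $(a;q)_\infty=\prod_{j\ge0}(1-aq^j)$ and $(a_1,\dots,a_k;q)_\infty=\prod_i(a_i;q)_\infty$, consider the deformed big $q$-Jacobi weight $$w(x;t)=\frac{(b_2x,\,b_3x,\,b_6^{-1}xt^{-1};q)_\infty}{(b_1x,\,b_4x,\,b_6xt^{-1};q)_\infty}$$ and the Thomae–Jackson $q$-integral $\int_{\alpha}^{\beta}d_qx$ whose terminals are two different ones among the zeros $b_2^{-1},\,b_3^{-1},\,b_6t$ of the weight (the same choice at all times); assume that at the times $t$ and $qt$ the weight has no pole on the lattices $\{\alpha q^s\}_{s\ge0}$, $\{\beta q^s\}_{s\ge0}$. Assume that at the times $t$ and $qt$ there are orthonormal polynomials $p_n$, $\int_\alpha^\beta d_qx\,w\,p_mp_n=\delta_{mn}$, $\deg p_n=n$ $(n\ge0)$, with leading coefficients $\gamma_n\neq 0$. Put $a_n=\gamma_{n-1}/\gamma_n$ for $n\ge1$,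 let $a_0\ne0$ be arbitrary, $q_n(x)=\int_\alpha^\beta d_qy\,\frac{w(y)p_n(y)}{x-y}$, $p_{-1}=0$, $q_{-1}=1/(a_0\gamma_0)$, and $$Y_n=\begin{pmatrix}p_n&q_n/w\\p_{n-1}&q_{n-1}/w\end{pmatrix}.$$ Define polynomials $W,V$ in $x$ by $W+\Delta y\,V=b_6(1-b_1x)(1-b_4x)(t-b_6x)$, $W-\Delta y\,V=(1-b_2x)(1-b_3x)(b_6t-x)$, $\Delta y=(q-1)x$. The spectral coefficients are the polynomials $W_n,\Omega_n,\Theta_n,\Theta_{n-1}$ in $x$ such that $$W_n(x)\,\frac{Y_n(qx)-Y_n(x)}{(q-1)x}=\begin{pmatrix}\Omega_n&-a_n\Theta_n\\a_n\Theta_{n-1}&-\Omega_n-2V\end{pmatrix}(x)\;\frac{Y_n(qx)+Y_n(x)}2$$ for all $x\neq0$ such that neither $x$ nor $qx$ lies on the two lattices and $x$ is neither a zero nor a pole of $w$ (neither the numerator nor the denominator of $w$ vanishes at $x$). Fix $n\ge0$ and let $b_5=b_1b_4b_6q^n$. At any given time, let $\lambda_n$ be the zero of $\Theta_n$, $\nu_n=(2W_n-W)(\lambda_n)$,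 $\mu_n=(\Omega_n+V)(\lambda_n)$, and let $\kappa_\pm=w_3\pm(q-1)v_2$, where $w_3$ is the coefficient of $x^3$ in $2W_n-W$ and $v_2$ that of $x^2$ in $\Omega_n+V$. Define $z_\pm$ by $\nu_n=\frac12\lambda_n(\kappa_+z_++\kappa_-z_-)$, $\mu_n=\frac1{2(q-1)}(\kappa_+z_+-\kappa_-z_-)$, then $$\mathcal Z=-\frac{b_5b_6t}{(\lambda_n-b_6t)(b_6\lambda_n-t)}\,z_++\frac{b_5t\lambda_n-1}{\lambda_n},\qquad g(t)=\lambda_n(t),\qquad f(q^{-1}t)=b_5t-\mathcal Z(t).$$ Write $\hat{\ }$ for the replacement $t\mapsto qt$. **Proposition.** Assume in addition $q\,b_5^2\ne1$. Then the spectral coefficients at time $qt$ exist and are unique, and $\hat\Theta_n$ has exactly one zero $\hat g=\hat\lambda_n$. If $\hat g\ne0,\;b_6qt,\;b_6^{-1}qt$ (so that $f=f(t)$ is defined) and $f\neq b_5qt,\;b_5^{-1}t$, then $$\left(\frac{\hat\gamma_n}{b_6\gamma_n}\right)^2=\frac{f-b_5^{-1}t}{f-b_5qt}.$$ -/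

import Mathlib

open Polynomial

noncomputable section

namespace QE6

/-- The base `q` and the parameters of the deformed big q-Jacobi weight (plain data; the
constraints on them are hypotheses of the theorem). -/
structure Param where
  q : ℂ
  b1 : ℂ
  b2 : ℂ
  b3 : ℂ
  b4 : ℂ
  b6 : ℂ

/-- The q-shifted factorial `(a;q)_∞`. -/
def qPoch (a q : ℂ) : ℂ := ∏' j : ℕ, (1 - a * q ^ j)

/-- Numerator `(b₂x, b₃x, b₆⁻¹xt⁻¹; q)_∞` of the weight. -/
def wNum (P : Param) (x t : ℂ) : ℂ :=
  qPoch (P.b2 * x) P.q * qPoch (P.b3 * x) P.q * qPoch (P.b6⁻¹ * x * t⁻¹) P.q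

/-- Denominator `(b₁x, b₄x, b₆xt⁻¹; q)_∞` of the weight. -/
def wDen (P : Param) (x t : ℂ) : ℂ :=
  qPoch (P.b1 * x) P.q * qPoch (P.b4 * x) P.q * qPoch (P.b6 * x * t⁻¹) P.q

/-- The deformed big q-Jacobi weight `w(x;t)`. -/
def weight (P : Param) (x t : ℂ) : ℂ := wNum P x t / wDen P x t

/-- The three (families of) zeros of the weight at which a q-integral can terminate. -/
inductive Terminal where
  | b2inv
  | b3inv
  | b6t

/-- The position of a terminal: `b₂⁻¹`, `b₃⁻¹` or `b₆t`. -/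
def Terminal.point (P : Param) (t : ℂ) : Terminal → ℂ
  | .b2inv => P.b2⁻¹
  | .b3inv => P.b3⁻¹
  | .b6t => P.b6 * t

/-- The Thomae–Jackson q-integral `∫_a^b d_q x F(x)`. -/
def jackson (q a b : ℂ) (F : ℂ → ℂ) : ℂ :=
  (1 - q) * (b * ∑' s : ℕ, q ^ s * F (b * q ^ s)) -
    (1 - q) * (a * ∑' s : ℕ, q ^ s * F (a * q ^ s))

/-- Integration `∫_α^β d_q x w(x;t) F(x)` against the weight, between the terminals `α`, `β`. -/
def wInt (P : Param) (α β : Terminal) (t : ℂ) (F : ℂ → ℂ) : ℂ :=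
  jackson P.q (α.point P t) (β.point P t) (fun x => weight P x t * F x)

/-- The lattice on which the q-integral is supported. -/
def lattice (P : Param) (α β : Terminal) (t : ℂ) : Set ℂ :=
  Set.range (fun s : ℕ => α.point P t * P.q ^ s) ∪
    Set.range (fun s : ℕ => β.point P t * P.q ^ s)

/-- `p` is the (orthonormal) orthogonal polynomial system of the weight at time `t`. -/
structure IsOPS (P : Param) (α β : Terminal) (t : ℂ) (p : ℕ → ℂ[X]) : Prop where
  degree_eq : ∀ n, (p n).degree = n
  orthonormal : ∀ m n,
    wInt P α β t (fun x => (p m).eval x * (p n).eval x) = if m = n then 1 else 0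

/-- The leading coefficient `γ_n`. -/
def gam (p : ℕ → ℂ[X]) (n : ℕ) : ℂ := (p n).leadingCoeff

/-- The coefficients `a_n` of the three-term recurrence
`a_{n+1} p_{n+1} = (x - b_n) p_n - a_n p_{n-1}`: comparing leading coefficients,
`a_{n+1} = γ_n / γ_{n+1}`; `a_0` is a free normalisation constant, as `p_{-1} = 0`. -/
def recA (a0 : ℂ) (p : ℕ → ℂ[X]) : ℕ → ℂ
  | 0 => a0
  | n + 1 => gam p n / gam p (n + 1)

/-- The associated function `q_n(x) = ∫ d_q y w(y;t) p_n(y) / (x - y)`. -/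
def assoc (P : Param) (α β : Terminal) (t : ℂ) (p : ℕ → ℂ[X]) (n : ℕ) (x : ℂ) : ℂ :=
  wInt P α β t (fun y => (p n).eval y / (x - y))

/-- `p_{n-1}(x)`, with `p_{-1} = 0`. -/
def polyPrev (p : ℕ → ℂ[X]) (n : ℕ) (x : ℂ) : ℂ :=
  match n with
  | 0 => 0
  | m + 1 => (p m).eval x

/-- `q_{n-1}(x)`, with `q_{-1} = 1 / (a_0 γ_0)`. -/
def assocPrev (P : Param) (α β : Terminal) (t a0 : ℂ) (p : ℕ → ℂ[X]) (n : ℕ) (x : ℂ) : ℂ :=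
  match n with
  | 0 => 1 / (a0 * gam p 0)
  | m + 1 => assoc P α β t p m x

/-- The matrix variable `Y_n(x;t)`. -/
def Ymat (P : Param) (α β : Terminal) (t a0 : ℂ) (p : ℕ → ℂ[X]) (n : ℕ) (x : ℂ) :
    Matrix (Fin 2) (Fin 2) ℂ :=
  !![(p n).eval x, assoc P α β t p n x / weight P x t;
     polyPrev p n x, assocPrev P α β t a0 p n x / weight P x t]

/-- Divided-difference operator on the q-linear lattice (`y₊ = qx`, `y₋ = x`), entrywise. -/
def ddo (q : ℂ) (F : ℂ → Matrix (Fin 2) (Fin 2) ℂ) (x : ℂ) : Matrix (Fin 2) (Fin 2) ℂ :=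
  ((q - 1) * x)⁻¹ • (F (q * x) - F x)

/-- Mean operator on the q-linear lattice, entrywise. -/
def meanOp (q : ℂ) (F : ℂ → Matrix (Fin 2) (Fin 2) ℂ) (x : ℂ) : Matrix (Fin 2) (Fin 2) ℂ :=
  (1 / 2 : ℂ) • (F (q * x) + F x)

/-- `W + Δy V = b₆ (1 - b₁x)(1 - b₄x)(t - b₆x)`. -/
def specPlus (P : Param) (t : ℂ) : ℂ[X] :=
  C P.b6 * (1 - C P.b1 * X) * (1 - C P.b4 * X) * (C t - C P.b6 * X)

/-- `W - Δy V = (1 - b₂x)(1 - b₃x)(b₆t - x)`. -/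
def specMinus (P : Param) (t : ℂ) : ℂ[X] :=
  (1 - C P.b2 * X) * (1 - C P.b3 * X) * (C (P.b6 * t) - X)

/-- The spectral data polynomial `W`. -/
def specW (P : Param) (t : ℂ) : ℂ[X] := C (1 / 2) * (specPlus P t + specMinus P t)

/-- The spectral data polynomial `V`, where `Δy = (q - 1) x`. The difference of the two
polynomials has no constant term, so `divX` is exact division by `x`. -/
def specV (P : Param) (t : ℂ) : ℂ[X] :=
  C (1 / (2 * (P.q - 1))) * (specPlus P t - specMinus P t).divX

/-- The four spectral coefficients `W_n`, `Ω_n`, `Θ_n`, `Θ_{n-1}` (polynomials in `x`). -/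
structure SpectralCoeffs where
  W : ℂ[X]
  Om : ℂ[X]
  Th : ℂ[X]
  ThPrev : ℂ[X]

/-- `W_n(x) A_n(x)`, where `A_n` is the spectral matrix and `a = a_n`. -/
def SpectralCoeffs.mat (S : SpectralCoeffs) (P : Param) (t a x : ℂ) :
    Matrix (Fin 2) (Fin 2) ℂ :=
  !![S.Om.eval x, -(a * S.Th.eval x);
     a * S.ThPrev.eval x, -S.Om.eval x - 2 * (specV P t).eval x]

/-- `S` consists of the spectral coefficients: the spectral divided-difference equation
`𝔻ₓ Y_n = A_n 𝕄ₓ Y_n` holds, multiplied through by `W_n`, at all points where `Y_n(x)` and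
`Y_n(qx)` are defined (off the lattice, and off the zeros and poles of the weight). -/
def IsSpectral (P : Param) (α β : Terminal) (t a0 : ℂ) (p : ℕ → ℂ[X]) (n : ℕ)
    (S : SpectralCoeffs) : Prop :=
  ∀ x : ℂ, x ≠ 0 → x ∉ lattice P α β t → P.q * x ∉ lattice P α β t →
    wNum P x t ≠ 0 → wDen P x t ≠ 0 →
    S.W.eval x • ddo P.q (Ymat P α β t a0 p n) x =
      S.mat P t (recA a0 p n) x * meanOp P.q (Ymat P α β t a0 p n) x

/-- The polynomial `2W_n - W`. -/
def SpectralCoeffs.w (S : SpectralCoeffs) (P : Param) (t : ℂ) : ℂ[X] := 2 * S.W - specW P t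

/-- The polynomial `Ω_n + V`. -/
def SpectralCoeffs.v (S : SpectralCoeffs) (P : Param) (t : ℂ) : ℂ[X] := S.Om + specV P t

/-- `κ₊ = w₃ + (q - 1) v₂`, with `w₃ = [x³](2W_n - W)` and `v₂ = [x²](Ω_n + V)`. -/
def SpectralCoeffs.kappaPlus (S : SpectralCoeffs) (P : Param) (t : ℂ) : ℂ :=
  (S.w P t).coeff 3 + (P.q - 1) * (S.v P t).coeff 2

/-- The variable `z₊`: with `ν = (2W_n - W)(λ)` and `μ = (Ω_n + V)(λ)`, the solution of
`ν = ½ λ (κ₊ z₊ + κ₋ z₋)`, `μ = (κ₊ z₊ - κ₋ z₋) / (2 (q - 1))`. -/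
def SpectralCoeffs.zPlus (S : SpectralCoeffs) (P : Param) (t lam : ℂ) : ℂ :=
  ((S.w P t).eval lam / lam + (P.q - 1) * (S.v P t).eval lam) / S.kappaPlus P t

/-- The variable `Z(t)`; here `lam` is the zero of `Θ_n(x;t)`. -/
def SpectralCoeffs.Z (S : SpectralCoeffs) (P : Param) (b5 t lam : ℂ) : ℂ :=
  -(b5 * P.b6 * t) / ((lam - P.b6 * t) * (P.b6 * lam - t)) * S.zPlus P t lam +
    (b5 * t * lam - 1) / lam

/-- The value `f(q⁻¹t) = b₅t - Z(t)`, computed from the spectral coefficients at time `t`. -/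
def SpectralCoeffs.fRetarded (S : SpectralCoeffs) (P : Param) (b5 t lam : ℂ) : ℂ :=
  b5 * t - S.Z P b5 t lam

end QE6

end

noncomputable section

namespace QE6

open Filter Topology

/-! ### The `q`-shifted factorial -/

/-! Write `A = W + Δy V`, `B = W - Δy V` and `τ = qt`, with hats for time `τ`. The argument replaces
the spectral matrix by the transfer matrix `T = A(x) Y_n(qx) Y_n(x)⁻¹`, which is a polynomial in
`x`.

Since `det Y_n = 1/(a_n w)` (`IsOPS.casoratian`) and `w(qx) B(x) = w(x) A(x)` (`weight_shift`), each
entry of `T` is, up to a constant, a combination `A(x) u(qx) Q_v(x) - B(x) v(x) Q_u(qx)` of Cauchy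
transforms (for `n = 0` partly degenerate). Both products are a polynomial plus a Cauchy transform,
and the two remaining transforms are equal after the substitution `y ↦ qy` in the q-integral. So the
combination is a polynomial (`exists_bilinear`), whose coefficients are pairings that orthogonality
evaluates. The telescoped Pearson equation gives `T(0) = b₆t` times the identity
(`polyInt_divX_sub`).

The spectral equation is the Cayley transform of `A Y_n(qx) = T Y_n(x)`. Together with the
prescribed trace `-2V` it determines the spectral coefficients (`cayley_entries`,
`IsSpectral.eq_transferCoeffs`). In particular `Θ_n` is a multiple of `T₁₂/x`, and `2W_n - W +
(q-1)x(Ω_n + V) = T₁₁`. Hence `z₊ = T₁₁(λ)/(λ [x³]T₁₁)`, and `f` is an affine function of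
`T̂₁₁(λ̂)`.

In the time direction, `b₆(τ - b₆x) w(x;τ) = (b₆τ - x) w(x;t)` yields `b₆(τ - b₆x) p_n = (s₁x + s₀)
p̂_n + s₂ p̂_{n-1}` and a companion relation for the associated functions (`exists_time_evolution`),
where `s₁` and `s₂` depend on `γ_n/γ̂_n`. The mixed shift `(x,t) ↦ (qx,qt)` of the weight gives
another polynomial bilinear expression, and eliminating produces `(b₆τ - x)(τ - b₆x) K = (s₁x + s₀)
T̂₁₂ - s₂ T̂₁₁` (`exists_compatibility`).

By degree `K` is linear. The coefficient of `x³` and the value at `0` determine `K` without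
involving `s₀`. At `x = λ̂` the term with `T̂₁₂` disappears, and the identity becomes `s₂(f - b₅τ) =
s₁ a_n (b₅τ - b₅⁻¹t)`, with `a_n` taken at time `τ`; inserting `s₁` and `s₂` gives the claim. -/

theorem summable_norm_mul_pow {q : ℂ} (hq : ‖q‖ < 1) (a : ℂ) :
    Summable fun j : ℕ => ‖-(a * q ^ j)‖ := by
  simp only [norm_neg, norm_mul, norm_pow]
  exact (summable_geometric_of_lt_one (norm_nonneg _) hq).mul_left _

theorem multipliable_qPoch {q : ℂ} (hq : ‖q‖ < 1) (a : ℂ) :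
    Multipliable fun j : ℕ => (1 - a * q ^ j) := by
  simpa [sub_eq_add_neg] using multipliable_one_add_of_summable (summable_norm_mul_pow hq a)

theorem qPoch_eq_mul {q : ℂ} (hq : ‖q‖ < 1) (a : ℂ) :
    qPoch a q = (1 - a) * qPoch (a * q) q := by
  have h : Multipliable fun j : ℕ => (1 - a * q ^ (j + 1)) := by
    have := multipliable_qPoch hq (a * q)
    refine this.congr fun j => ?_
    ring
  have h1 : qPoch (a * q) q = ∏' j : ℕ, (1 - a * q ^ (j + 1)) :=
    tprod_congr fun j => by rw [pow_succ']; ring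
  have h2 := tprod_eq_zero_mul' (f := fun j : ℕ => (1 - a * q ^ j)) h
  rw [h1, qPoch, h2, pow_zero, mul_one]

theorem qPoch_zero (q : ℂ) : qPoch 0 q = 1 := by simp [qPoch]

theorem qPoch_one {q : ℂ} (hq : ‖q‖ < 1) : qPoch 1 q = 0 := by
  rw [qPoch_eq_mul hq]; simp

/-- A quantitative bound for the convergence of the product to `1`. It yields continuity at the
origin, the only analytic regularity needed, because both lattices accumulate only there. -/
theorem norm_qPoch_sub_one_le {q : ℂ} (hq : ‖q‖ < 1) (a : ℂ) :
    ‖qPoch a q - 1‖ ≤ Real.exp (‖a‖ * (1 - ‖q‖)⁻¹) - 1 := by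
  have h := (multipliable_qPoch hq a).hasProd.tendsto_prod_nat
  have h2 := (h.sub_const 1).norm
  refine le_of_tendsto' h2 fun N => ?_
  have h3 := Finset.norm_prod_one_add_sub_one_le (Finset.range N) (fun j => -(a * q ^ j))
  simp only [← sub_eq_add_neg] at h3
  refine h3.trans ?_
  gcongr
  have h4 := (summable_norm_mul_pow hq a).sum_le_tsum (Finset.range N)
    (fun _ _ => norm_nonneg _)
  refine h4.trans (le_of_eq ?_)
  simp only [norm_neg, norm_mul, norm_pow]
  rw [tsum_mul_left, tsum_geometric_of_lt_one (norm_nonneg _) hq]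

theorem continuousAt_qPoch_mul {q : ℂ} (hq : ‖q‖ < 1) (c : ℂ) :
    ContinuousAt (fun x => qPoch (c * x) q) 0 := by
  rw [ContinuousAt, mul_zero, qPoch_zero, tendsto_iff_norm_sub_tendsto_zero]
  refine squeeze_zero (fun _ => norm_nonneg _) (fun x => norm_qPoch_sub_one_le hq (c * x)) ?_
  have : Continuous fun x : ℂ => Real.exp (‖c * x‖ * (1 - ‖q‖)⁻¹) - 1 := by fun_prop
  simpa using this.tendsto 0

/-! ### The weight -/

theorem continuousAt_wNum {P : Param} (hq : ‖P.q‖ < 1) (t : ℂ) :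
    ContinuousAt (fun x => wNum P x t) 0 := by
  unfold wNum
  refine ((continuousAt_qPoch_mul hq _).mul (continuousAt_qPoch_mul hq _)).mul ?_
  simpa only [mul_right_comm] using continuousAt_qPoch_mul hq (P.b6⁻¹ * t⁻¹)

theorem continuousAt_wDen {P : Param} (hq : ‖P.q‖ < 1) (t : ℂ) :
    ContinuousAt (fun x => wDen P x t) 0 := by
  unfold wDen
  refine ((continuousAt_qPoch_mul hq _).mul (continuousAt_qPoch_mul hq _)).mul ?_
  simpa only [mul_right_comm] using continuousAt_qPoch_mul hq (P.b6 * t⁻¹)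

theorem wNum_zero (P : Param) (t : ℂ) : wNum P 0 t = 1 := by simp [wNum, qPoch_zero]

theorem wDen_zero (P : Param) (t : ℂ) : wDen P 0 t = 1 := by simp [wDen, qPoch_zero]

theorem weight_zero (P : Param) (t : ℂ) : weight P 0 t = 1 := by
  simp [weight, wNum_zero, wDen_zero]

theorem continuousAt_weight {P : Param} (hq : ‖P.q‖ < 1) (t : ℂ) :
    ContinuousAt (fun x => weight P x t) 0 :=
  (continuousAt_wNum hq t).div (continuousAt_wDen hq t) (by simp [wDen_zero])

theorem wNum_shift {P : Param} (hq : ‖P.q‖ < 1) (x t : ℂ) :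
    wNum P x t =
      (1 - P.b2 * x) * (1 - P.b3 * x) * (1 - P.b6⁻¹ * x * t⁻¹) * wNum P (P.q * x) t := by
  unfold wNum
  rw [qPoch_eq_mul hq (P.b2 * x), qPoch_eq_mul hq (P.b3 * x), qPoch_eq_mul hq (P.b6⁻¹ * x * t⁻¹),
    show P.b2 * x * P.q = P.b2 * (P.q * x) by ring, show P.b3 * x * P.q = P.b3 * (P.q * x) by ring,
    show P.b6⁻¹ * x * t⁻¹ * P.q = P.b6⁻¹ * (P.q * x) * t⁻¹ by ring]
  ring

theorem wDen_shift {P : Param} (hq : ‖P.q‖ < 1) (x t : ℂ) :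
    wDen P x t =
      (1 - P.b1 * x) * (1 - P.b4 * x) * (1 - P.b6 * x * t⁻¹) * wDen P (P.q * x) t := by
  unfold wDen
  rw [qPoch_eq_mul hq (P.b1 * x), qPoch_eq_mul hq (P.b4 * x), qPoch_eq_mul hq (P.b6 * x * t⁻¹),
    show P.b1 * x * P.q = P.b1 * (P.q * x) by ring, show P.b4 * x * P.q = P.b4 * (P.q * x) by ring,
    show P.b6 * x * t⁻¹ * P.q = P.b6 * (P.q * x) * t⁻¹ by ring]
  ring

theorem wNum_time_shift {P : Param} (hq0 : P.q ≠ 0) (hq : ‖P.q‖ < 1) (x t : ℂ) :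
    wNum P x (P.q * t) = (1 - P.b6⁻¹ * x * (P.q * t)⁻¹) * wNum P x t := by
  unfold wNum
  rw [qPoch_eq_mul hq (P.b6⁻¹ * x * (P.q * t)⁻¹),
    show P.b6⁻¹ * x * (P.q * t)⁻¹ * P.q = P.b6⁻¹ * x * t⁻¹ by
      rw [mul_inv]; field_simp]
  ring

theorem wDen_time_shift {P : Param} (hq0 : P.q ≠ 0) (hq : ‖P.q‖ < 1) (x t : ℂ) :
    wDen P x (P.q * t) = (1 - P.b6 * x * (P.q * t)⁻¹) * wDen P x t := by
  unfold wDen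
  rw [qPoch_eq_mul hq (P.b6 * x * (P.q * t)⁻¹),
    show P.b6 * x * (P.q * t)⁻¹ * P.q = P.b6 * x * t⁻¹ by
      rw [mul_inv]; field_simp]
  ring

/-- `w(qx;qt) (1 - b₂x)(1 - b₃x) = w(x;t) (1 - b₁x)(1 - b₄x)`. -/
theorem weight_mixed_shift {P : Param} (hq0 : P.q ≠ 0) (hq : ‖P.q‖ < 1) {x t : ℂ}
    (hx : wDen P x t ≠ 0) :
    weight P (P.q * x) (P.q * t) * ((1 - P.b2 * x) * (1 - P.b3 * x)) =
      weight P x t * ((1 - P.b1 * x) * (1 - P.b4 * x)) := by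
  have e1 : P.b6⁻¹ * (P.q * x) * (P.q * t)⁻¹ = P.b6⁻¹ * x * t⁻¹ := by
    rw [mul_inv]; field_simp
  have e2 : P.b6 * (P.q * x) * (P.q * t)⁻¹ = P.b6 * x * t⁻¹ := by
    rw [mul_inv]; field_simp
  unfold weight
  rw [wNum_time_shift hq0 hq, wDen_time_shift hq0 hq, e1, e2, wNum_shift hq x t]
  rw [wDen_shift hq x t] at hx ⊢
  have h1 := left_ne_zero_of_mul hx
  have h2 := right_ne_zero_of_mul hx
  have h3 := right_ne_zero_of_mul h1
  have h4 := left_ne_zero_of_mul h1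
  have h5 := left_ne_zero_of_mul h4
  have h6 := right_ne_zero_of_mul h4
  rw [div_mul_eq_mul_div, div_mul_eq_mul_div, div_eq_div_iff (mul_ne_zero h3 h2) hx]
  ring

/-- `b₆ (qt - b₆x) w(x;qt) = (b₆qt - x) w(x;t)`. -/
theorem weight_time_shift {P : Param} (hq0 : P.q ≠ 0) (hq : ‖P.q‖ < 1) (hb6 : P.b6 ≠ 0)
    {x t : ℂ} (ht : t ≠ 0) (hx : wDen P x (P.q * t) ≠ 0) :
    weight P x (P.q * t) * (P.b6 * (P.q * t - P.b6 * x)) =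
      weight P x t * (P.b6 * (P.q * t) - x) := by
  have hqt : P.q * t ≠ 0 := mul_ne_zero hq0 ht
  unfold weight
  rw [wNum_time_shift hq0 hq]
  rw [wDen_time_shift hq0 hq] at hx ⊢
  have h1 := left_ne_zero_of_mul hx
  have h2 := right_ne_zero_of_mul hx
  have h3 : P.q * t - P.b6 * x ≠ 0 := by
    intro h
    apply h1
    rw [show P.b6 * x = P.q * t by linear_combination -h, mul_inv_cancel₀ hqt, sub_self]
  have e1 : 1 - P.b6⁻¹ * x * (P.q * t)⁻¹ = (P.b6 * (P.q * t) - x) / (P.b6 * (P.q * t)) := by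
    field_simp
  have e2 : 1 - P.b6 * x * (P.q * t)⁻¹ = (P.q * t - P.b6 * x) / (P.q * t) := by
    field_simp
  rw [e1, e2]
  generalize P.q * t - P.b6 * x = z at *
  generalize P.q * t = y at *
  field_simp

theorem specPlus_eval (P : Param) (t x : ℂ) : (specPlus P t).eval x =
    P.b6 * (1 - P.b1 * x) * (1 - P.b4 * x) * (t - P.b6 * x) := by simp [specPlus]

theorem specMinus_eval (P : Param) (t x : ℂ) : (specMinus P t).eval x =
    (1 - P.b2 * x) * (1 - P.b3 * x) * (P.b6 * t - x) := by simp [specMinus]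

/-- The Pearson equation `w(qx) (W - Δy V)(x) = w(x) (W + Δy V)(x)`. -/
theorem weight_shift {P : Param} (hq : ‖P.q‖ < 1) (hb6 : P.b6 ≠ 0)
    {x t : ℂ} (ht : t ≠ 0) (hx : wDen P x t ≠ 0) :
    weight P (P.q * x) t * (specMinus P t).eval x = weight P x t * (specPlus P t).eval x := by
  rw [specPlus_eval, specMinus_eval]
  unfold weight
  rw [wNum_shift hq x t]
  rw [wDen_shift hq x t] at hx ⊢
  have h1 := left_ne_zero_of_mul hx
  have h2 := right_ne_zero_of_mul hx
  rw [div_mul_eq_mul_div, div_mul_eq_mul_div, div_eq_div_iff h2 hx]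
  have e1 : 1 - P.b6⁻¹ * x * t⁻¹ = (P.b6 * t - x) / (P.b6 * t) := by field_simp
  have e2 : 1 - P.b6 * x * t⁻¹ = (t - P.b6 * x) / t := by field_simp
  rw [e1, e2]
  field_simp

theorem wNum_point {P : Param} {t : ℂ} (hq : ‖P.q‖ < 1) (ht : t ≠ 0)
    (hb : P.b1 * P.b2 * P.b3 * P.b4 = 1) (hb6 : P.b6 ≠ 0) (κ : Terminal) :
    wNum P (κ.point P t) t = 0 := by
  have h := hb ▸ one_ne_zero (α := ℂ)
  have h2 : P.b2 ≠ 0 := fun h2 => h (by simp [h2])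
  have h3 : P.b3 ≠ 0 := fun h3 => h (by simp [h3])
  cases κ
  · simp [wNum, Terminal.point, h2, qPoch_one hq]
  · simp [wNum, Terminal.point, h3, qPoch_one hq]
  · rw [wNum, Terminal.point, show P.b6⁻¹ * (P.b6 * t) * t⁻¹ = 1 by field_simp, qPoch_one hq,
      mul_zero]

/-- This boundary zero is what lets the sums be shifted by one step, and lets the telescoping sums
start from zero. -/
theorem weight_point {P : Param} {t : ℂ} (hq : ‖P.q‖ < 1) (ht : t ≠ 0)
    (hb : P.b1 * P.b2 * P.b3 * P.b4 = 1) (hb6 : P.b6 ≠ 0) (κ : Terminal) :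
    weight P (κ.point P t) t = 0 := by
  rw [weight, wNum_point hq ht hb hb6, zero_div]

/-! ### Sums over the lattices -/

/-- The standing assumptions at time `t`. -/
structure IsAdmissible (P : Param) (α β : Terminal) (t : ℂ) : Prop where
  q_ne : P.q ≠ 0
  q_lt : ‖P.q‖ < 1
  t_ne : t ≠ 0
  prod_eq : P.b1 * P.b2 * P.b3 * P.b4 = 1
  b6_ne : P.b6 ≠ 0
  wDen_left : ∀ s : ℕ, wDen P (α.point P t * P.q ^ s) t ≠ 0
  wDen_right : ∀ s : ℕ, wDen P (β.point P t * P.q ^ s) t ≠ 0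

/-- The sum over one lattice underlying the `q`-integral against the weight. -/
def latSum (P : Param) (κ : Terminal) (t : ℂ) (F : ℂ → ℂ) : ℂ :=
  ∑' s : ℕ, κ.point P t * P.q ^ s *
    (weight P (κ.point P t * P.q ^ s) t * F (κ.point P t * P.q ^ s))

theorem wInt_eq_latSum (P : Param) (α β : Terminal) (t : ℂ) (F : ℂ → ℂ) :
    wInt P α β t F = (1 - P.q) * (latSum P β t F - latSum P α t F) := by
  simp only [wInt, jackson, latSum, ← tsum_mul_left, mul_sub, mul_assoc]

theorem tendsto_lattice {q : ℂ} (hq : ‖q‖ < 1) (c : ℂ) :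
    Tendsto (fun s : ℕ => c * q ^ s) atTop (𝓝 0) := by
  simpa using (tendsto_pow_atTop_nhds_zero_of_norm_lt_one hq).const_mul c

/-- Along the lattice `w F` converges, hence is bounded, and the factor `q ^ s` gives geometric
decay. -/
theorem summable_latSum {P : Param} (hq : ‖P.q‖ < 1) (κ : Terminal) (t : ℂ) {F : ℂ → ℂ}
    (hF : ContinuousAt F 0) :
    Summable fun s : ℕ => κ.point P t * P.q ^ s *
      (weight P (κ.point P t * P.q ^ s) t * F (κ.point P t * P.q ^ s)) := by
  have h := (((continuousAt_weight hq t).mul hF).tendsto.comp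
    (tendsto_lattice hq (κ.point P t))).norm
  obtain ⟨M, hM⟩ := h.bddAbove_range
  refine Summable.of_norm_bounded (g := fun s => ‖κ.point P t‖ * ‖P.q‖ ^ s * M)
    (((summable_geometric_of_lt_one (norm_nonneg _) hq).mul_left _).mul_right _) fun s => ?_
  rw [norm_mul, norm_mul (κ.point P t), norm_pow]
  gcongr
  exact hM ⟨s, rfl⟩

theorem wInt_add {P : Param} (hq : ‖P.q‖ < 1) (α β : Terminal) (t : ℂ) {F G : ℂ → ℂ}
    (hF : ContinuousAt F 0) (hG : ContinuousAt G 0) :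
    wInt P α β t (fun y => F y + G y) = wInt P α β t F + wInt P α β t G := by
  have key : ∀ κ, latSum P κ t (fun y => F y + G y) = latSum P κ t F + latSum P κ t G := by
    intro κ
    unfold latSum
    rw [← (summable_latSum hq κ t hF).tsum_add (summable_latSum hq κ t hG)]
    exact tsum_congr fun s => by ring
  simp only [wInt_eq_latSum, key]
  ring

theorem wInt_const_mul (P : Param) (α β : Terminal) (t c : ℂ) (F : ℂ → ℂ) :
    wInt P α β t (fun y => c * F y) = c * wInt P α β t F := by
  have key : ∀ κ, latSum P κ t (fun y => c * F y) = c * latSum P κ t F := by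
    intro κ
    unfold latSum
    rw [← tsum_mul_left]
    exact tsum_congr fun s => by ring
  simp only [wInt_eq_latSum, key]
  ring

theorem wInt_congr {P : Param} {α β : Terminal} {t : ℂ} {F G : ℂ → ℂ}
    (h : ∀ y ∈ lattice P α β t, F y = G y) : wInt P α β t F = wInt P α β t G := by
  rw [wInt_eq_latSum, wInt_eq_latSum]
  congr 2 <;> refine tsum_congr fun s => ?_
  · rw [h _ (Or.inr ⟨s, rfl⟩)]
  · rw [h _ (Or.inl ⟨s, rfl⟩)]

/-- A series whose zeroth term vanishes may be shifted, without summability. -/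
theorem tsum_eq_tsum_succ {f : ℕ → ℂ} (h : f 0 = 0) : ∑' s, f s = ∑' s, f (s + 1) := by
  refine ((add_left_injective 1).tsum_eq (f := f) ?_).symm
  intro s hs
  cases s with
  | zero => exact absurd h hs
  | succ s => exact ⟨s, rfl⟩

theorem latSum_eq_succ {P : Param} {t : ℂ} (hq : ‖P.q‖ < 1) (ht : t ≠ 0)
    (hb : P.b1 * P.b2 * P.b3 * P.b4 = 1) (hb6 : P.b6 ≠ 0) (κ : Terminal) (F : ℂ → ℂ) :
    latSum P κ t F = ∑' s : ℕ, κ.point P t * P.q ^ (s + 1) *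
      (weight P (κ.point P t * P.q ^ (s + 1)) t * F (κ.point P t * P.q ^ (s + 1))) := by
  unfold latSum
  rw [tsum_eq_tsum_succ]
  rw [pow_zero, mul_one, weight_point hq ht hb hb6]
  ring

/-- Change of variables `y ↦ qy` combined with the Pearson equation. The term at the terminal, which
the shift misses on the right, carries zero weight. -/
theorem latSum_shift {P : Param} {t : ℂ} (hq0 : P.q ≠ 0) (hq : ‖P.q‖ < 1) (ht : t ≠ 0)
    (hb : P.b1 * P.b2 * P.b3 * P.b4 = 1) (hb6 : P.b6 ≠ 0) {κ : Terminal}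
    (hκ : ∀ s : ℕ, wDen P (κ.point P t * P.q ^ s) t ≠ 0) {g h : ℂ → ℂ}
    (hgh : ∀ y, P.q * h (P.q * y) = g y) :
    latSum P κ t (fun y => (specPlus P t).eval y * g y) =
      latSum P κ t (fun y => (specMinus P t).eval (P.q⁻¹ * y) * h y) := by
  rw [latSum_eq_succ hq ht hb hb6 κ (fun y => (specMinus P t).eval (P.q⁻¹ * y) * h y)]
  refine tsum_congr fun s => ?_
  have h1 := weight_shift hq hb6 ht (hκ s)
  rw [show κ.point P t * P.q ^ (s + 1) = P.q * (κ.point P t * P.q ^ s) by ring]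
  generalize κ.point P t * P.q ^ s = y at *
  beta_reduce
  rw [← hgh, inv_mul_cancel_left₀ hq0]
  linear_combination -(y * P.q * h (P.q * y)) * h1

theorem latSum_mixed_shift {P : Param} {t : ℂ} (hq0 : P.q ≠ 0) (hq : ‖P.q‖ < 1) (ht : t ≠ 0)
    (hb : P.b1 * P.b2 * P.b3 * P.b4 = 1) (hb6 : P.b6 ≠ 0) {κ : Terminal}
    (hκ : ∀ s : ℕ, wDen P (κ.point P t * P.q ^ s) t ≠ 0) {g h : ℂ → ℂ}
    (hgh : ∀ y, P.q * h (P.q * y) = g y) :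
    latSum P κ t (fun y => (1 - P.b1 * y) * (1 - P.b4 * y) * g y) =
      latSum P κ (P.q * t) (fun y =>
        (1 - P.b2 * (P.q⁻¹ * y)) * (1 - P.b3 * (P.q⁻¹ * y)) * h y) := by
  rw [latSum_eq_succ hq (mul_ne_zero hq0 ht) hb hb6 κ (fun y =>
    (1 - P.b2 * (P.q⁻¹ * y)) * (1 - P.b3 * (P.q⁻¹ * y)) * h y)]
  have key : ∀ y, wDen P y t ≠ 0 → y * (weight P y t *
      ((1 - P.b1 * y) * (1 - P.b4 * y) * g y)) = P.q * y * (weight P (P.q * y) (P.q * t) *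
      ((1 - P.b2 * (P.q⁻¹ * (P.q * y))) * (1 - P.b3 * (P.q⁻¹ * (P.q * y))) * h (P.q * y))) := by
    intro y hy
    rw [← hgh, inv_mul_cancel_left₀ hq0]
    linear_combination -(y * P.q * h (P.q * y)) * weight_mixed_shift hq0 hq hy
  -- The terminals `b₂⁻¹`, `b₃⁻¹` do not move with time, whereas `b₆t` moves to `q b₆t`. In the last
  -- case the map `y ↦ qy` matches the two lattices from their starting points, so the zeroth term
  -- is dropped on both sides.
  cases κ
  · refine tsum_congr fun s => ?_
    rw [show Terminal.point P (P.q * t) .b2inv * P.q ^ (s + 1) =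
      P.q * (Terminal.point P t .b2inv * P.q ^ s) by simp only [Terminal.point]; ring]
    exact key _ (hκ s)
  · refine tsum_congr fun s => ?_
    rw [show Terminal.point P (P.q * t) .b3inv * P.q ^ (s + 1) =
      P.q * (Terminal.point P t .b3inv * P.q ^ s) by simp only [Terminal.point]; ring]
    exact key _ (hκ s)
  · rw [latSum_eq_succ hq ht hb hb6]
    refine tsum_congr fun s => ?_
    rw [show Terminal.point P (P.q * t) .b6t * P.q ^ (s + 1) =
      P.q * (Terminal.point P t .b6t * P.q ^ (s + 1)) by simp only [Terminal.point]; ring]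
    exact key _ (hκ (s + 1))

theorem latSum_time_shift {P : Param} {t : ℂ} (hq0 : P.q ≠ 0) (hq : ‖P.q‖ < 1) (ht : t ≠ 0)
    (hb : P.b1 * P.b2 * P.b3 * P.b4 = 1) (hb6 : P.b6 ≠ 0) {κ : Terminal}
    (hκ : ∀ s : ℕ, wDen P (κ.point P (P.q * t) * P.q ^ s) (P.q * t) ≠ 0) (F : ℂ → ℂ) :
    latSum P κ (P.q * t) (fun y => P.b6 * (P.q * t - P.b6 * y) * F y) =
      latSum P κ t (fun y => (P.b6 * (P.q * t) - y) * F y) := by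
  have key : ∀ y, wDen P y (P.q * t) ≠ 0 →
      y * (weight P y (P.q * t) * (P.b6 * (P.q * t - P.b6 * y) * F y)) =
        y * (weight P y t * ((P.b6 * (P.q * t) - y) * F y)) := by
    intro y hy
    linear_combination y * F y * weight_time_shift hq0 hq hb6 ht hy
  -- For a fixed terminal the identity is termwise. For `b₆t`, the lattice at time `qt` is the
  -- lattice at time `t` without its first point, where the weight at time `t` vanishes.
  cases κ
  · exact tsum_congr fun s => key _ (hκ s)
  · exact tsum_congr fun s => key _ (hκ s)
  · rw [latSum_eq_succ hq ht hb hb6]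
    refine tsum_congr fun s => ?_
    rw [show Terminal.point P t .b6t * P.q ^ (s + 1) =
      Terminal.point P (P.q * t) .b6t * P.q ^ s by simp only [Terminal.point]; ring]
    exact key _ (hκ s)

/-- The telescoping form of the Pearson equation. -/
theorem latSum_pearson {P : Param} {t : ℂ} (hq0 : P.q ≠ 0) (hq : ‖P.q‖ < 1) (ht : t ≠ 0)
    (hb : P.b1 * P.b2 * P.b3 * P.b4 = 1) (hb6 : P.b6 ≠ 0) {κ : Terminal}
    (hκ : ∀ s : ℕ, wDen P (κ.point P t * P.q ^ s) t ≠ 0) {f g : ℂ → ℂ}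
    (hf : ContinuousAt f 0) (hg : ContinuousAt g 0)
    (hfg : ∀ y, y * g y =
      (specPlus P t).eval y * f (P.q * y) - (specMinus P t).eval (P.q⁻¹ * y) * f y) :
    latSum P κ t g = P.b6 * t * f 0 := by
  -- By the Pearson equation `w(y) A(y) f(qy) = G(qy)`, so each summand is `G(qy) - G(y)`. The
  -- partial sums run from the terminal, where `G = 0`, towards the origin, where `G` tends to `b₆t
  -- f(0)`.
  set G : ℂ → ℂ := fun y => weight P y t * ((specMinus P t).eval (P.q⁻¹ * y) * f y) with hG
  have hGc : ContinuousAt G 0 :=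
    (continuousAt_weight hq t).mul ((by fun_prop : Continuous fun y =>
      (specMinus P t).eval (P.q⁻¹ * y)).continuousAt.mul hf)
  have hlim : Tendsto (fun s : ℕ => G (κ.point P t * P.q ^ s)) atTop (𝓝 (P.b6 * t * f 0)) := by
    have := hGc.tendsto.comp (tendsto_lattice hq (κ.point P t))
    simpa [hG, weight_zero, specMinus_eval, Function.comp_def] using this
  have hsum := (summable_latSum hq κ t hg).hasSum.tendsto_sum_nat
  refine tendsto_nhds_unique hsum (hlim.congr fun N => ?_)
  have hterm : ∀ s : ℕ, κ.point P t * P.q ^ s *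
      (weight P (κ.point P t * P.q ^ s) t * g (κ.point P t * P.q ^ s)) =
      G (κ.point P t * P.q ^ (s + 1)) - G (κ.point P t * P.q ^ s) := by
    intro s
    have h1 := weight_shift hq hb6 ht (hκ s)
    rw [show κ.point P t * P.q ^ (s + 1) = P.q * (κ.point P t * P.q ^ s) by ring]
    generalize κ.point P t * P.q ^ s = y at *
    simp only [hG, inv_mul_cancel_left₀ hq0]
    linear_combination weight P y t * hfg y - f (P.q * y) * h1
  rw [Finset.sum_congr rfl fun s _ => hterm s,
    Finset.sum_range_sub (fun s => G (κ.point P t * P.q ^ s))]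
  simp [hG, weight_point hq ht hb hb6]

/-! ### Consequences for the `q`-integral -/

theorem wInt_shift {P : Param} {α β : Terminal} {t : ℂ} (H : IsAdmissible P α β t) {g h : ℂ → ℂ}
    (hgh : ∀ y, P.q * h (P.q * y) = g y) :
    wInt P α β t (fun y => (specPlus P t).eval y * g y) =
      wInt P α β t (fun y => (specMinus P t).eval (P.q⁻¹ * y) * h y) := by
  rw [wInt_eq_latSum, wInt_eq_latSum,
    latSum_shift H.q_ne H.q_lt H.t_ne H.prod_eq H.b6_ne H.wDen_left hgh,
    latSum_shift H.q_ne H.q_lt H.t_ne H.prod_eq H.b6_ne H.wDen_right hgh]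

theorem wInt_mixed_shift {P : Param} {α β : Terminal} {t : ℂ} (H : IsAdmissible P α β t)
    {g h : ℂ → ℂ} (hgh : ∀ y, P.q * h (P.q * y) = g y) :
    wInt P α β t (fun y => (1 - P.b1 * y) * (1 - P.b4 * y) * g y) =
      wInt P α β (P.q * t) (fun y =>
        (1 - P.b2 * (P.q⁻¹ * y)) * (1 - P.b3 * (P.q⁻¹ * y)) * h y) := by
  rw [wInt_eq_latSum, wInt_eq_latSum,
    latSum_mixed_shift H.q_ne H.q_lt H.t_ne H.prod_eq H.b6_ne H.wDen_left hgh,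
    latSum_mixed_shift H.q_ne H.q_lt H.t_ne H.prod_eq H.b6_ne H.wDen_right hgh]

theorem wInt_time_shift {P : Param} {α β : Terminal} {t : ℂ} (ht : t ≠ 0)
    (H : IsAdmissible P α β (P.q * t)) (F : ℂ → ℂ) :
    wInt P α β (P.q * t) (fun y => P.b6 * (P.q * t - P.b6 * y) * F y) =
      wInt P α β t (fun y => (P.b6 * (P.q * t) - y) * F y) := by
  rw [wInt_eq_latSum, wInt_eq_latSum,
    latSum_time_shift H.q_ne H.q_lt ht H.prod_eq H.b6_ne H.wDen_left,
    latSum_time_shift H.q_ne H.q_lt ht H.prod_eq H.b6_ne H.wDen_right]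

/-- Both lattices end at the origin with the same limit `b₆t f(0)`, which cancels in the difference
of the two sums. -/
theorem wInt_pearson {P : Param} {α β : Terminal} {t : ℂ} (H : IsAdmissible P α β t)
    {f g : ℂ → ℂ} (hf : ContinuousAt f 0) (hg : ContinuousAt g 0)
    (hfg : ∀ y, y * g y =
      (specPlus P t).eval y * f (P.q * y) - (specMinus P t).eval (P.q⁻¹ * y) * f y) :
    wInt P α β t g = 0 := by
  rw [wInt_eq_latSum,
    latSum_pearson H.q_ne H.q_lt H.t_ne H.prod_eq H.b6_ne H.wDen_left hf hg hfg,
    latSum_pearson H.q_ne H.q_lt H.t_ne H.prod_eq H.b6_ne H.wDen_right hf hg hfg]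
  ring

/-! ### Moments and Cauchy transforms -/

/-- Integration of polynomials against the weight. -/
def polyInt {P : Param} (hq : ‖P.q‖ < 1) (α β : Terminal) (t : ℂ) : ℂ[X] →ₗ[ℂ] ℂ where
  toFun f := wInt P α β t fun y => f.eval y
  map_add' f g := by
    simp only [eval_add]
    exact wInt_add hq α β t f.continuous.continuousAt g.continuous.continuousAt
  map_smul' c f := by
    simp only [eval_smul, smul_eq_mul, RingHom.id_apply]
    exact wInt_const_mul P α β t c _

theorem polyInt_apply {P : Param} (hq : ‖P.q‖ < 1) (α β : Terminal) (t : ℂ) (f : ℂ[X]) :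
    polyInt hq α β t f = wInt P α β t fun y => f.eval y := rfl

theorem polyInt_C_mul {P : Param} (hq : ‖P.q‖ < 1) (α β : Terminal) (t c : ℂ) (f : ℂ[X]) :
    polyInt hq α β t (C c * f) = c * polyInt hq α β t f := by
  rw [← smul_eq_C_mul, map_smul, smul_eq_mul]

/-- The Cauchy transform `∫ d_q y w(y) v(y) / (x - y)` of a polynomial. -/
def cauchy (P : Param) (α β : Terminal) (t : ℂ) (v : ℂ[X]) (x : ℂ) : ℂ :=
  wInt P α β t fun y => v.eval y / (x - y)

theorem continuousAt_cauchy_kernel (v : ℂ[X]) {x : ℂ} (hx : x ≠ 0) :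
    ContinuousAt (fun y => v.eval y / (x - y)) 0 :=
  v.continuous.continuousAt.div (by fun_prop) (by simpa using hx)

theorem cauchy_add {P : Param} (hq : ‖P.q‖ < 1) (α β : Terminal) (t : ℂ) (u v : ℂ[X]) {x : ℂ}
    (hx : x ≠ 0) :
    cauchy P α β t (u + v) x = cauchy P α β t u x + cauchy P α β t v x := by
  unfold cauchy
  rw [← wInt_add hq α β t (continuousAt_cauchy_kernel u hx) (continuousAt_cauchy_kernel v hx)]
  simp only [eval_add, add_div]

theorem cauchy_C_mul (P : Param) (α β : Terminal) (t c : ℂ) (v : ℂ[X]) (x : ℂ) :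
    cauchy P α β t (C c * v) x = c * cauchy P α β t v x := by
  unfold cauchy
  rw [← wInt_const_mul]
  simp only [eval_mul, eval_C, mul_div_assoc]

theorem mul_cauchy {P : Param} (hq : ‖P.q‖ < 1) (α β : Terminal) (t : ℂ) (v : ℂ[X]) {x : ℂ}
    (hx : x ≠ 0) (hl : x ∉ lattice P α β t) :
    x * cauchy P α β t v x = polyInt hq α β t v + cauchy P α β t (v * X) x := by
  unfold cauchy
  rw [polyInt_apply, ← wInt_add hq α β t v.continuous.continuousAt
    (continuousAt_cauchy_kernel _ hx), ← wInt_const_mul]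
  refine wInt_congr fun y hy => ?_
  have : x - y ≠ 0 := fun h => hl (by rwa [sub_eq_zero.mp h])
  simp only [eval_mul, eval_X]
  field_simp
  ring

/-- Multiplying a Cauchy transform by a polynomial gives a polynomial plus a Cauchy transform. -/
theorem exists_eval_mul_cauchy {P : Param} (hq : ‖P.q‖ < 1) (α β : Terminal) (t : ℂ)
    (v F : ℂ[X]) : ∃ R : ℂ[X],
      (∀ i, R.coeff i = polyInt hq α β t (v * divX^[i + 1] F)) ∧
      ∀ x, x ≠ 0 → x ∉ lattice P α β t →
        F.eval x * cauchy P α β t v x = R.eval x + cauchy P α β t (v * F) x := by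
  -- The difference quotient `(F(x) - F(y))/(x - y)` has `x^i`-coefficient `(divX^[i+1] F)(y)`. The
  -- induction builds it up through `F = X * divX F + F(0)`.
  induction hN : F.natDegree generalizing F with
  | zero =>
    rw [eq_C_of_natDegree_eq_zero hN]
    refine ⟨0, fun i => ?_, fun x _ _ => ?_⟩
    · rw [Function.iterate_succ_apply, divX_C, Function.iterate_fixed divX_zero]
      simp
    · rw [mul_comm v, cauchy_C_mul]
      simp
  | succ N ih =>
    obtain ⟨R, hR, hRx⟩ := ih (divX F) (by rw [natDegree_divX_eq_natDegree_tsub_one, hN]; rfl)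
    refine ⟨R * X + C (polyInt hq α β t (v * divX F)), fun i => ?_, fun x hx hl => ?_⟩
    · cases i with
      | zero => simp
      | succ i => simp [hR i]
    · have h1 := hRx x hx hl
      have h2 := mul_cauchy hq α β t (v * divX F) hx hl
      have h3 : v * F = v * divX F * X + C (F.coeff 0) * v := by
        conv_lhs => rw [← divX_mul_X_add F]
        ring
      have h4 : F.eval x = (divX F).eval x * x + F.coeff 0 := by
        conv_lhs => rw [← divX_mul_X_add F]
        simp
      rw [h3, cauchy_add hq _ _ _ _ _ hx, cauchy_C_mul, h4]
      simp only [eval_add, eval_mul, eval_X, eval_C]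
      linear_combination x * h1 + h2

/-- The combination of Cauchy transforms on two lattices attached to a Pearson-type relation is
a polynomial. -/
theorem exists_bilinear {P : Param} (hq : ‖P.q‖ < 1) (hq0 : P.q ≠ 0) (α β : Terminal)
    (t₁ t₂ : ℂ) (c d u v : ℂ[X])
    (hstar : ∀ x, cauchy P α β t₁ (v * (c * u.comp (C P.q * X))) x =
      cauchy P α β t₂ (u * (d * v).comp (C P.q⁻¹ * X)) (P.q * x)) :
    ∃ Φ : ℂ[X],
      (∀ i, Φ.coeff i = polyInt hq α β t₁ (v * divX^[i + 1] (c * u.comp (C P.q * X))) -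
        P.q ^ i * polyInt hq α β t₂ (u * divX^[i + 1] ((d * v).comp (C P.q⁻¹ * X)))) ∧
      ∀ x, x ≠ 0 → x ∉ lattice P α β t₁ → P.q * x ∉ lattice P α β t₂ →
        Φ.eval x = c.eval x * u.eval (P.q * x) * cauchy P α β t₁ v x -
          d.eval x * v.eval x * cauchy P α β t₂ u (P.q * x) := by
  obtain ⟨R, hR, hRx⟩ := exists_eval_mul_cauchy hq α β t₁ v (c * u.comp (C P.q * X))
  obtain ⟨S, hS, hSx⟩ := exists_eval_mul_cauchy hq α β t₂ u ((d * v).comp (C P.q⁻¹ * X))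
  refine ⟨R - S.comp (C P.q * X), fun i => ?_, fun x hx h1 h2 => ?_⟩
  · rw [coeff_sub, comp_C_mul_X_coeff, hR, hS, mul_comm (P.q ^ i)]
  · have e1 := hRx x hx h1
    have e2 := hSx (P.q * x) (mul_ne_zero hq0 hx) h2
    rw [hstar] at e1
    simp only [eval_mul, eval_comp, eval_C, eval_X, inv_mul_cancel_left₀ hq0, eval_sub] at *
    linear_combination e2 - e1

theorem exists_bilinear_same {P : Param} {α β : Terminal} {t : ℂ} (H : IsAdmissible P α β t)
    (u v : ℂ[X]) : ∃ Φ : ℂ[X],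
      (∀ i, Φ.coeff i =
        polyInt H.q_lt α β t (v * divX^[i + 1] (specPlus P t * u.comp (C P.q * X))) - P.q ^ i *
          polyInt H.q_lt α β t (u * divX^[i + 1] ((specMinus P t * v).comp (C P.q⁻¹ * X)))) ∧
      ∀ x, x ≠ 0 → x ∉ lattice P α β t → P.q * x ∉ lattice P α β t →
        Φ.eval x = (specPlus P t).eval x * u.eval (P.q * x) * cauchy P α β t v x -
          (specMinus P t).eval x * v.eval x * cauchy P α β t u (P.q * x) := by
  refine exists_bilinear H.q_lt H.q_ne α β t t _ _ u v fun x => ?_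
  have hq0 := H.q_ne
  -- The kernels satisfy `q/(qx - qy) = 1/(x - y)`, also at `x = y` with the value `0` for division
  -- by zero. Thus the two transforms agree at every `x`.
  have h := wInt_shift H (g := fun y => v.eval y * u.eval (P.q * y) / (x - y))
    (h := fun y => v.eval (P.q⁻¹ * y) * u.eval y / (P.q * x - y)) (fun y => by
      rw [inv_mul_cancel_left₀ hq0, ← mul_sub, mul_div_assoc', mul_div_mul_left _ _ hq0])
  unfold cauchy
  convert h using 3 with y y
  · simp only [eval_mul, eval_comp, eval_C, eval_X]
    ring
  · simp only [eval_mul, eval_comp, eval_C, eval_X]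
    ring

/-- The Pearson-type relation here is `weight_mixed_shift`, in which space and time move together.
The factors with `b₆` cancel, so both multipliers are only quadratic. -/
theorem exists_bilinear_mixed {P : Param} {α β : Terminal} {t : ℂ} (H : IsAdmissible P α β t)
    (u v : ℂ[X]) : ∃ Φ : ℂ[X],
      ∀ x, x ≠ 0 → x ∉ lattice P α β t → P.q * x ∉ lattice P α β (P.q * t) →
        Φ.eval x = (1 - P.b1 * x) * (1 - P.b4 * x) * u.eval (P.q * x) * cauchy P α β t v x -
          (1 - P.b2 * x) * (1 - P.b3 * x) * v.eval x *
            cauchy P α β (P.q * t) u (P.q * x) := by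
  obtain ⟨Φ, -, hΦ⟩ := exists_bilinear H.q_lt H.q_ne α β t (P.q * t)
    ((1 - C P.b1 * X) * (1 - C P.b4 * X)) ((1 - C P.b2 * X) * (1 - C P.b3 * X)) u v (fun x => by
      have hq0 := H.q_ne
      have h := wInt_mixed_shift H (g := fun y => v.eval y * u.eval (P.q * y) / (x - y))
        (h := fun y => v.eval (P.q⁻¹ * y) * u.eval y / (P.q * x - y)) (fun y => by
          rw [inv_mul_cancel_left₀ hq0, ← mul_sub, mul_div_assoc', mul_div_mul_left _ _ hq0])
      unfold cauchy
      convert h using 3 with y y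
      · simp only [eval_mul, eval_comp, eval_C, eval_X, eval_sub, eval_one]
        ring
      · simp only [eval_mul, eval_comp, eval_C, eval_X, eval_sub, eval_one]
        ring)
  exact ⟨Φ, fun x h1 h2 h3 => by simpa using hΦ x h1 h2 h3⟩

/-- The value at the origin of the bilinear polynomial of `exists_bilinear_same`. -/
theorem polyInt_divX_sub {P : Param} {α β : Terminal} {t : ℂ} (H : IsAdmissible P α β t)
    (u v : ℂ[X]) :
    polyInt H.q_lt α β t (v * divX (specPlus P t * u.comp (C P.q * X))) -
        polyInt H.q_lt α β t (u * divX ((specMinus P t * v).comp (C P.q⁻¹ * X))) =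
      P.b6 * t * (polyInt H.q_lt α β t (v * divX u) - polyInt H.q_lt α β t (u * divX v)) := by
  set F := specPlus P t * u.comp (C P.q * X) with hF
  set G := (specMinus P t * v).comp (C P.q⁻¹ * X) with hG
  have hpe : wInt P α β t (fun y => (v * divX F - u * divX G -
      C (P.b6 * t) * (v * divX u - u * divX v)).eval y) = 0 := by
    -- With this `f` the Pearson difference is `v F - u G`. Since `F(0) = b₆t u(0)` and `G(0) = b₆t
    -- v(0)`, removing constant terms leaves a multiple of `y`.
    refine wInt_pearson H (f := fun y => v.eval (P.q⁻¹ * y) * u.eval y)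
      (by fun_prop) (by fun_prop) fun y => ?_
    have key : ∀ (p : ℂ[X]), p.eval y = (divX p).eval y * y + p.eval 0 := by
      intro p
      conv_lhs => rw [← divX_mul_X_add p]
      simp [coeff_zero_eq_eval_zero]
    have hF1 := key F
    have hG1 := key G
    have hu := key u
    have hv := key v
    have hA : (specPlus P t).eval 0 = P.b6 * t := by simp [specPlus_eval]
    have hB : (specMinus P t).eval 0 = P.b6 * t := by simp [specMinus_eval]
    simp only [hF, hG, eval_mul, eval_comp, eval_C, eval_X, mul_zero, hA, hB] at hF1 hG1
    rw [← hF] at hF1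
    rw [← hG] at hG1
    simp only [eval_sub, eval_mul, eval_C, inv_mul_cancel_left₀ H.q_ne]
    linear_combination -v.eval y * hF1 + u.eval y * hG1 + P.b6 * t * v.eval y * hu -
      P.b6 * t * u.eval y * hv
  rw [← polyInt_apply H.q_lt] at hpe
  simp only [map_sub, polyInt_C_mul] at hpe
  linear_combination hpe

/-! ### Generic points -/

theorem lattice_countable (P : Param) (α β : Terminal) (t : ℂ) : (lattice P α β t).Countable :=
  (Set.countable_range _).union (Set.countable_range _)

/-- A neighbourhood of the origin in `ℂ` is uncountable: the complement of a countable set is dense.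
-/
theorem infinite_setOf_eventually {s : Set ℂ} (hs : s ∈ 𝓝 (0 : ℂ)) {Z : Set ℂ}
    (hZ : Z.Countable) : (s \ Z).Infinite := by
  intro hfin
  have h1 : s.Countable := (hfin.countable.union hZ).mono (by
    intro x hx
    by_cases h : x ∈ Z
    · exact Or.inr h
    · exact Or.inl ⟨hx, h⟩)
  have h2 := (h1.dense_compl ℂ).inter_nhds_nonempty hs
  obtain ⟨x, hx1, hx2⟩ := h2
  exact hx1 hx2

/-- Points at which the Cauchy transforms at `x` and `qx` converge and the weight is regular. -/
def generic (P : Param) (α β : Terminal) (t : ℂ) : Set ℂ :=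
  {x | x ≠ 0 ∧ x ∉ lattice P α β t ∧ P.q * x ∉ lattice P α β t ∧
    wNum P x t ≠ 0 ∧ wDen P x t ≠ 0}

theorem countable_preimage_lattice {P : Param} (hq0 : P.q ≠ 0) (α β : Terminal) (t : ℂ) :
    ((fun x => P.q * x) ⁻¹' lattice P α β t).Countable :=
  (lattice_countable P α β t).preimage (mul_right_injective₀ hq0)

theorem generic_inter_infinite {P : Param} (hq0 : P.q ≠ 0) (hq : ‖P.q‖ < 1) (α β : Terminal)
    (t : ℂ) {Z : Set ℂ} (hZ : Z.Countable) : (generic P α β t \ Z).Infinite := by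
  have h1 : ∀ᶠ x in 𝓝 (0 : ℂ), wNum P x t ≠ 0 :=
    (continuousAt_wNum hq t).eventually_ne (by simp [wNum_zero])
  have h2 : ∀ᶠ x in 𝓝 (0 : ℂ), wDen P x t ≠ 0 :=
    (continuousAt_wDen hq t).eventually_ne (by simp [wDen_zero])
  refine (infinite_setOf_eventually (h1.and h2) (((Set.countable_singleton 0).union
    ((lattice_countable P α β t).union (countable_preimage_lattice hq0 α β t))).union hZ)).mono ?_
  rintro x ⟨⟨hn, hd⟩, hx⟩
  simp only [Set.mem_union, Set.mem_singleton_iff, Set.mem_preimage, not_or] at hx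
  exact ⟨⟨hx.1.1, hx.1.2.1, hx.1.2.2, hn, hd⟩, hx.2⟩

/-- This turns identities of functions, valid off lattices and off zeros and poles of the weight,
into identities of polynomials. -/
theorem eq_of_generic {P : Param} (hq0 : P.q ≠ 0) (hq : ‖P.q‖ < 1) (α β : Terminal)
    (t : ℂ) {Z : Set ℂ} (hZ : Z.Countable) {f g : ℂ[X]}
    (h : ∀ x ∈ generic P α β t, x ∉ Z → f.eval x = g.eval x) : f = g :=
  eq_of_infinite_eval_eq f g
    ((generic_inter_infinite hq0 hq α β t hZ).mono fun x hx => h x hx.1 hx.2)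

/-! ### Orthogonality -/

theorem coeff_iterate_divX (F : ℂ[X]) (i j : ℕ) : (divX^[i] F).coeff j = F.coeff (j + i) := by
  induction i generalizing F with
  | zero => rfl
  | succ i ih => rw [Function.iterate_succ_apply, ih, coeff_divX, add_assoc]

namespace IsOPS

variable {P : Param} {α β : Terminal} {t : ℂ} {p : ℕ → ℂ[X]}

theorem natDegree_eq (hp : IsOPS P α β t p) (n : ℕ) : (p n).natDegree = n :=
  natDegree_eq_of_degree_eq_some (hp.degree_eq n)

theorem gam_eq_coeff (hp : IsOPS P α β t p) (n : ℕ) : gam p n = (p n).coeff n := by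
  rw [gam, leadingCoeff, hp.natDegree_eq]

theorem gam_ne_zero (hp : IsOPS P α β t p) (n : ℕ) : gam p n ≠ 0 := by
  have : p n ≠ 0 := by
    intro h
    have := hp.degree_eq n
    simp [h] at this
  exact leadingCoeff_ne_zero.mpr this

theorem recA_ne_zero (hp : IsOPS P α β t p) {a0 : ℂ} (ha0 : a0 ≠ 0) (n : ℕ) :
    recA a0 p n ≠ 0 := by
  cases n with
  | zero => exact ha0
  | succ n => exact div_ne_zero (hp.gam_ne_zero _) (hp.gam_ne_zero _)

theorem polyInt_mul (hp : IsOPS P α β t p) (hq : ‖P.q‖ < 1) (m n : ℕ) :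
    polyInt hq α β t (p m * p n) = if m = n then 1 else 0 := by
  rw [polyInt_apply, ← hp.orthonormal m n]
  simp only [eval_mul]

theorem degree_sub_lt (hp : IsOPS P α β t p) {k : ℕ} {f : ℂ[X]} (hf : f.natDegree ≤ k) :
    (f - C (f.coeff k / gam p k) * p k).degree < k := by
  rw [degree_lt_iff_coeff_zero]
  intro m hm
  rw [coeff_sub, coeff_C_mul]
  rcases hm.eq_or_lt with rfl | hm
  · rw [← hp.gam_eq_coeff, div_mul_cancel₀ _ (hp.gam_ne_zero _), sub_self]
  · rw [coeff_eq_zero_of_natDegree_lt (hf.trans_lt hm),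
      coeff_eq_zero_of_natDegree_lt ((hp.natDegree_eq k).trans_lt hm)]
    simp

theorem polyInt_mul_of_degree_lt (hp : IsOPS P α β t p) (hq : ‖P.q‖ < 1) {n : ℕ} {f : ℂ[X]}
    (hf : f.degree < n) : polyInt hq α β t (p n * f) = 0 := by
  suffices h : ∀ k ≤ n, ∀ f : ℂ[X], f.degree < k → polyInt hq α β t (p n * f) = 0 from
    h n le_rfl f hf
  intro k
  induction k with
  | zero =>
    intro _ f hf
    have : f = 0 := degree_eq_bot.mp (Nat.WithBot.lt_zero_iff.mp hf)
    simp [this]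
  | succ k ih =>
    intro hk f hf
    have h1 := ih (by omega) _ (hp.degree_sub_lt (natDegree_le_iff_coeff_eq_zero.mpr
      fun N hN => (degree_lt_iff_coeff_zero _ _).mp hf N hN))
    rw [mul_sub, map_sub, mul_left_comm, polyInt_C_mul, hp.polyInt_mul, if_neg (by omega)] at h1
    simpa using h1

theorem polyInt_mul_of_natDegree_le (hp : IsOPS P α β t p) (hq : ‖P.q‖ < 1) {n : ℕ} {f : ℂ[X]}
    (hf : f.natDegree ≤ n) : polyInt hq α β t (p n * f) = f.coeff n / gam p n := by
  have h := hp.polyInt_mul_of_degree_lt hq (hp.degree_sub_lt hf)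
  rw [mul_sub, map_sub, mul_left_comm, polyInt_C_mul, hp.polyInt_mul, if_pos rfl] at h
  linear_combination h

/-- Under this degree bound orthogonality sees only the top coefficient. This evaluates the
coefficients of the bilinear polynomials. -/
theorem polyInt_mul_iterate_divX (hp : IsOPS P α β t p) (hq : ‖P.q‖ < 1) {n i : ℕ} {F : ℂ[X]}
    (hF : F.natDegree ≤ n + i) :
    polyInt hq α β t (p n * divX^[i] F) = F.coeff (n + i) / gam p n := by
  rw [hp.polyInt_mul_of_natDegree_le hq, coeff_iterate_divX]
  rw [natDegree_le_iff_coeff_eq_zero]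
  intro N hN
  rw [coeff_iterate_divX, coeff_eq_zero_of_natDegree_lt (by omega)]

/-- Nondegeneracy of the pairing on polynomials of degree less than `n`. -/
theorem eq_zero_of_orthogonal (hp : IsOPS P α β t p) (hq : ‖P.q‖ < 1) {n : ℕ} {f : ℂ[X]}
    (hf : f.degree < n) (h : ∀ k < n, polyInt hq α β t (f * p k) = 0) : f = 0 := by
  by_contra hne
  have hd : f.natDegree < n := (natDegree_lt_iff_degree_lt hne).mpr hf
  have h1 := h _ hd
  rw [mul_comm, hp.polyInt_mul_of_natDegree_le hq le_rfl] at h1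
  exact div_ne_zero (leadingCoeff_ne_zero.mpr hne) (hp.gam_ne_zero _) h1

/-- The Liouville-Ostrogradsky formula. -/
theorem casoratian (hp : IsOPS P α β t p) (hq : ‖P.q‖ < 1) {a0 : ℂ} (ha0 : a0 ≠ 0)
    (n : ℕ) {x : ℂ} (hx : x ≠ 0) (hl : x ∉ lattice P α β t) :
    recA a0 p n * ((p n).eval x * assocPrev P α β t a0 p n x -
      polyPrev p n x * assoc P α β t p n x) = 1 := by
  cases n with
  | zero =>
    have h0 : (p 0).eval x = gam p 0 := by
      rw [hp.gam_eq_coeff, eq_C_of_natDegree_eq_zero (hp.natDegree_eq 0)]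
      simp
    have hg := hp.gam_ne_zero 0
    simp only [recA, assocPrev, polyPrev, h0]
    field_simp
    ring
  | succ m =>
    -- Both products have the same Cauchy-transform part, that of `p m * p (m + 1)`. The Casoratian
    -- is therefore `R - S`, and orthogonality leaves only the constant `γ_{m+1}/γ_m`.
    obtain ⟨R, hR, hRx⟩ := exists_eval_mul_cauchy hq α β t (p m) (p (m + 1))
    obtain ⟨S, hS, hSx⟩ := exists_eval_mul_cauchy hq α β t (p (m + 1)) (p m)
    have hR' : R = C (gam p (m + 1) / gam p m) := by
      ext i
      rw [hR, hp.polyInt_mul_iterate_divX hq (by rw [hp.natDegree_eq]; omega), coeff_C]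
      cases i with
      | zero => rw [if_pos rfl, hp.gam_eq_coeff (m + 1)]
      | succ i =>
        rw [coeff_eq_zero_of_natDegree_lt (by rw [hp.natDegree_eq]; omega)]
        simp
    have hS' : S = 0 := by
      ext i
      rw [hS, hp.polyInt_mul_iterate_divX hq (by rw [hp.natDegree_eq]; omega),
        coeff_eq_zero_of_natDegree_lt (by rw [hp.natDegree_eq]; omega)]
      simp
    have e1 := hRx x hx hl
    have e2 := hSx x hx hl
    rw [hR', eval_C] at e1
    rw [hS', eval_zero, mul_comm (p (m + 1))] at e2
    have hg := hp.gam_ne_zero m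
    have hg' := hp.gam_ne_zero (m + 1)
    have e3 : (p (m + 1)).eval x * cauchy P α β t (p m) x -
        (p m).eval x * cauchy P α β t (p (m + 1)) x = gam p (m + 1) / gam p m := by
      linear_combination e1 - e2
    change gam p m / gam p (m + 1) * ((p (m + 1)).eval x * cauchy P α β t (p m) x -
        (p m).eval x * cauchy P α β t (p (m + 1)) x) = 1
    rw [e3]
    field_simp

end IsOPS

/-! ### The transfer matrix -/

theorem specPlus_eq_cubic (P : Param) (t : ℂ) : specPlus P t =
    C (-(P.b1 * P.b4 * P.b6 ^ 2)) * X ^ 3 +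
      C (P.b6 * (P.b1 * P.b4 * t + P.b6 * (P.b1 + P.b4))) * X ^ 2 +
      C (P.b6 * (-(P.b1 + P.b4) * t - P.b6)) * X + C (P.b6 * t) := by
  simp only [specPlus, map_mul, map_neg, map_add, map_sub, map_pow]
  ring

theorem specMinus_eq_cubic (P : Param) (t : ℂ) : specMinus P t =
    C (-(P.b2 * P.b3)) * X ^ 3 + C (P.b2 * P.b3 * (P.b6 * t) + (P.b2 + P.b3)) * X ^ 2 +
      C (-(P.b2 + P.b3) * (P.b6 * t) - 1) * X + C (P.b6 * t) := by
  simp only [specMinus, map_mul, map_neg, map_add, map_sub, map_one]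
  ring

theorem natDegree_specPlus_le (P : Param) (t : ℂ) : (specPlus P t).natDegree ≤ 3 := by
  rw [specPlus_eq_cubic]
  exact natDegree_cubic_le

theorem natDegree_specMinus_le (P : Param) (t : ℂ) : (specMinus P t).natDegree ≤ 3 := by
  rw [specMinus_eq_cubic]
  exact natDegree_cubic_le

theorem coeff_three_specPlus (P : Param) (t : ℂ) :
    (specPlus P t).coeff 3 = -(P.b1 * P.b4 * P.b6 ^ 2) := by
  rw [specPlus_eq_cubic]
  simp only [coeff_add, coeff_C_mul, coeff_X_pow, coeff_X, coeff_C]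
  norm_num

theorem coeff_three_specMinus (P : Param) (t : ℂ) :
    (specMinus P t).coeff 3 = -(P.b2 * P.b3) := by
  rw [specMinus_eq_cubic]
  simp only [coeff_add, coeff_C_mul, coeff_X_pow, coeff_X, coeff_C]
  norm_num

theorem natDegree_comp_C_mul_X_le (f : ℂ[X]) (r : ℂ) :
    (f.comp (C r * X)).natDegree ≤ f.natDegree := by
  rw [natDegree_le_iff_coeff_eq_zero]
  intro N hN
  rw [comp_C_mul_X_coeff, coeff_eq_zero_of_natDegree_lt hN, zero_mul]

/-- The polynomial matrix `T` with `(W + Δy V)(x) Y_n(qx) = T(x) Y_n(x)`. -/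
structure IsTransfer (P : Param) (α β : Terminal) (t a0 : ℂ) (p : ℕ → ℂ[X]) (n : ℕ)
    (T11 T12 T21 T22 : ℂ[X]) : Prop where
  coeff_zero_11 : T11.coeff 0 = P.b6 * t
  coeff_zero_12 : T12.coeff 0 = 0
  coeff_zero_21 : T21.coeff 0 = 0
  coeff_zero_22 : T22.coeff 0 = P.b6 * t
  natDegree_12 : T12.natDegree ≤ 2
  coeff_two_12 : T12.coeff 2 = -recA a0 p n *
    (P.q ^ n * (specPlus P t).coeff 3 - (P.q⁻¹) ^ (n + 1) * (specMinus P t).coeff 3)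
  eval_11 : ∀ x, x ≠ 0 → x ∉ lattice P α β t → P.q * x ∉ lattice P α β t →
    T11.eval x = recA a0 p n *
      ((specPlus P t).eval x * (p n).eval (P.q * x) * assocPrev P α β t a0 p n x -
        (specMinus P t).eval x * polyPrev p n x * assoc P α β t p n (P.q * x))
  eval_12 : ∀ x, x ≠ 0 → x ∉ lattice P α β t → P.q * x ∉ lattice P α β t →
    T12.eval x = -recA a0 p n *
      ((specPlus P t).eval x * (p n).eval (P.q * x) * assoc P α β t p n x -
        (specMinus P t).eval x * (p n).eval x * assoc P α β t p n (P.q * x))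
  eval_21 : ∀ x, x ≠ 0 → x ∉ lattice P α β t → P.q * x ∉ lattice P α β t →
    T21.eval x = recA a0 p n *
      ((specPlus P t).eval x * polyPrev p n (P.q * x) * assocPrev P α β t a0 p n x -
        (specMinus P t).eval x * polyPrev p n x * assocPrev P α β t a0 p n (P.q * x))
  eval_22 : ∀ x, x ≠ 0 → x ∉ lattice P α β t → P.q * x ∉ lattice P α β t →
    T22.eval x = -recA a0 p n *
      ((specPlus P t).eval x * polyPrev p n (P.q * x) * assoc P α β t p n x -
        (specMinus P t).eval x * (p n).eval x * assocPrev P α β t a0 p n (P.q * x))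

/-- The diagonal case `u = v = p n`. The antisymmetric pairing giving the value at `0` vanishes, and
`divX^[i+1]` lowers degree `n + 3` below `n` as soon as `i ≥ 3`, which leaves a quadratic. -/
theorem exists_transfer_12 {P : Param} {α β : Terminal} {t : ℂ} (H : IsAdmissible P α β t)
    {p : ℕ → ℂ[X]} (hp : IsOPS P α β t p) (n : ℕ) : ∃ Φ : ℂ[X],
      Φ.coeff 0 = 0 ∧ Φ.natDegree ≤ 2 ∧
      Φ.coeff 2 = P.q ^ n * (specPlus P t).coeff 3 -
        (P.q⁻¹) ^ (n + 1) * (specMinus P t).coeff 3 ∧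
      ∀ x, x ≠ 0 → x ∉ lattice P α β t → P.q * x ∉ lattice P α β t →
        Φ.eval x = (specPlus P t).eval x * (p n).eval (P.q * x) * assoc P α β t p n x -
          (specMinus P t).eval x * (p n).eval x * assoc P α β t p n (P.q * x) := by
  obtain ⟨Φ, hc, hx⟩ := exists_bilinear_same H (p n) (p n)
  have hq0 := H.q_ne
  have hg := hp.gam_ne_zero n
  have hd1 : ((p n).comp (C P.q * X)).natDegree ≤ n :=
    (natDegree_comp_C_mul_X_le _ _).trans (hp.natDegree_eq n).le
  have hd2 : (specPlus P t * (p n).comp (C P.q * X)).natDegree ≤ 3 + n :=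
    natDegree_mul_le_of_le (natDegree_specPlus_le P t) hd1
  have hd3 : (specMinus P t * p n).natDegree ≤ 3 + n :=
    natDegree_mul_le_of_le (natDegree_specMinus_le P t) (hp.natDegree_eq n).le
  have hd4 : ((specMinus P t * p n).comp (C P.q⁻¹ * X)).natDegree ≤ 3 + n :=
    (natDegree_comp_C_mul_X_le _ _).trans hd3
  refine ⟨Φ, ?_, ?_, ?_, hx⟩
  · have h := polyInt_divX_sub H (p n) (p n)
    rw [hc]
    simpa using h
  · rw [natDegree_le_iff_coeff_eq_zero]
    intro i hi
    rw [hc, hp.polyInt_mul_iterate_divX _ (by omega), hp.polyInt_mul_iterate_divX _ (by omega),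
      coeff_eq_zero_of_natDegree_lt (hd2.trans_lt (by omega)),
      coeff_eq_zero_of_natDegree_lt (hd4.trans_lt (by omega))]
    simp
  · rw [hc, hp.polyInt_mul_iterate_divX _ (by omega), hp.polyInt_mul_iterate_divX _ (by omega),
      comp_C_mul_X_coeff, show n + (2 + 1) = 3 + n by omega,
      coeff_mul_add_eq_of_natDegree_le (natDegree_specPlus_le P t) hd1,
      coeff_mul_add_eq_of_natDegree_le (natDegree_specMinus_le P t) (hp.natDegree_eq n).le,
      comp_C_mul_X_coeff, ← hp.gam_eq_coeff, show 3 + n = n + 1 + 2 by omega, pow_add _ (n + 1)]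
    field_simp

theorem exists_transfer {P : Param} {α β : Terminal} {t : ℂ} (H : IsAdmissible P α β t)
    {p : ℕ → ℂ[X]} (hp : IsOPS P α β t p) {a0 : ℂ} (ha0 : a0 ≠ 0) (n : ℕ) :
    ∃ T11 T12 T21 T22, IsTransfer P α β t a0 p n T11 T12 T21 T22 := by
  obtain ⟨Φ, h0, hd, h2, hx⟩ := exists_transfer_12 H hp n
  cases n with
  | zero =>
    have hev : ∀ x, (p 0).eval x = gam p 0 := by
      intro x
      rw [hp.gam_eq_coeff, eq_C_of_natDegree_eq_zero (hp.natDegree_eq 0)]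
      simp
    have hg := hp.gam_ne_zero 0
    -- With `p_{-1} = 0` and `q_{-1} = 1/(a₀γ₀)` the matrix is upper triangular with diagonal `A`,
    -- `B`.
    refine ⟨specPlus P t, C (-recA a0 p 0) * Φ, 0, specMinus P t, ?_, ?_, ?_, ?_, ?_, ?_, ?_, ?_,
      ?_, ?_⟩
    · simp [coeff_zero_eq_eval_zero, specPlus_eval]
    · rw [coeff_C_mul, h0, mul_zero]
    · simp
    · simp [coeff_zero_eq_eval_zero, specMinus_eval]
    · exact (natDegree_C_mul_le _ _).trans hd
    · rw [coeff_C_mul, h2]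
    · intro x _ _ _
      simp only [hev, recA, assocPrev, polyPrev]
      field_simp
      ring
    · intro x h1 h2 h3
      rw [eval_mul, eval_C, hx x h1 h2 h3]
    · intro x _ _ _
      simp [polyPrev]
    · intro x _ _ _
      simp only [hev, recA, assocPrev, polyPrev]
      field_simp
      ring
  | succ m =>
    obtain ⟨Φ', h0', hd', h2', hx'⟩ := exists_transfer_12 H hp m
    obtain ⟨Ψ, hc, hy⟩ := exists_bilinear_same H (p (m + 1)) (p m)
    obtain ⟨Ψ', hc', hy'⟩ := exists_bilinear_same H (p m) (p (m + 1))
    have hg := hp.gam_ne_zero m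
    have hg' := hp.gam_ne_zero (m + 1)
    have e1 : polyInt H.q_lt α β t (p m * divX (p (m + 1))) = gam p (m + 1) / gam p m := by
      have := hp.polyInt_mul_iterate_divX H.q_lt (n := m) (i := 1) (F := p (m + 1))
        (hp.natDegree_eq _).le
      rwa [← hp.gam_eq_coeff] at this
    have e2 : polyInt H.q_lt α β t (p (m + 1) * divX (p m)) = 0 := by
      have := hp.polyInt_mul_iterate_divX H.q_lt (n := m + 1) (i := 1) (F := p m)
        (by rw [hp.natDegree_eq]; omega)
      rwa [coeff_eq_zero_of_natDegree_lt (by rw [hp.natDegree_eq]; omega), zero_div] at this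
    have i1 := polyInt_divX_sub H (p (m + 1)) (p m)
    have i2 := polyInt_divX_sub H (p m) (p (m + 1))
    rw [e1, e2] at i1 i2
    have j1 : Ψ.coeff 0 = P.b6 * t * (gam p (m + 1) / gam p m) := by
      rw [hc]
      simpa using i1
    have j2 : Ψ'.coeff 0 = -(P.b6 * t * (gam p (m + 1) / gam p m)) := by
      rw [hc']
      simpa using i2
    refine ⟨C (recA a0 p (m + 1)) * Ψ, C (-recA a0 p (m + 1)) * Φ, C (recA a0 p (m + 1)) * Φ',
      C (-recA a0 p (m + 1)) * Ψ', ?_, ?_, ?_, ?_, ?_, ?_, ?_, ?_, ?_, ?_⟩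
    · rw [coeff_C_mul, j1, recA]
      field_simp
    · rw [coeff_C_mul, h0, mul_zero]
    · rw [coeff_C_mul, h0', mul_zero]
    · rw [coeff_C_mul, j2, recA]
      field_simp
    · exact (natDegree_C_mul_le _ _).trans hd
    · rw [coeff_C_mul, h2]
    · intro x h1 h2 h3
      rw [eval_mul, eval_C, hy x h1 h2 h3]
      rfl
    · intro x h1 h2 h3
      rw [eval_mul, eval_C, hx x h1 h2 h3]
    · intro x h1 h2 h3
      rw [eval_mul, eval_C, hx' x h1 h2 h3]
      rfl
    · intro x h1 h2 h3
      rw [eval_mul, eval_C, hy' x h1 h2 h3]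
      rfl

/-! ### Existence and uniqueness of the spectral coefficients -/

theorem q_sub_one_ne_zero {q : ℂ} (hq : ‖q‖ < 1) : q - 1 ≠ 0 := by
  intro h
  rw [sub_eq_zero.mp h] at hq
  simp at hq

theorem specPlus_ne_zero_of_wDen {P : Param} {t x : ℂ} (hq : ‖P.q‖ < 1) (ht : t ≠ 0)
    (hb6 : P.b6 ≠ 0) (hx : wDen P x t ≠ 0) : (specPlus P t).eval x ≠ 0 := by
  rw [wDen_shift hq] at hx
  have h1 := left_ne_zero_of_mul hx
  have e : (specPlus P t).eval x =
      P.b6 * t * ((1 - P.b1 * x) * (1 - P.b4 * x) * (1 - P.b6 * x * t⁻¹)) := by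
    rw [specPlus_eval]
    field_simp
  rw [e]
  exact mul_ne_zero (mul_ne_zero hb6 ht) h1

theorem specMinus_ne_zero_of_wNum {P : Param} {t x : ℂ} (hq : ‖P.q‖ < 1) (ht : t ≠ 0)
    (hb6 : P.b6 ≠ 0) (hx : wNum P x t ≠ 0) : (specMinus P t).eval x ≠ 0 := by
  rw [wNum_shift hq] at hx
  have h1 := left_ne_zero_of_mul hx
  have e : (specMinus P t).eval x =
      P.b6 * t * ((1 - P.b2 * x) * (1 - P.b3 * x) * (1 - P.b6⁻¹ * x * t⁻¹)) := by
    rw [specMinus_eval]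
    field_simp
  rw [e]
  exact mul_ne_zero (mul_ne_zero hb6 ht) h1

/-- At a terminal `B` vanishes, while `A` does not because the weight has no pole there. -/
theorem specPlus_sub_specMinus_ne_zero {P : Param} {α β : Terminal} {t : ℂ}
    (H : IsAdmissible P α β t) : specPlus P t - specMinus P t ≠ 0 := by
  have h1 : wDen P (α.point P t) t ≠ 0 := by simpa using H.wDen_left 0
  have h2 := specPlus_ne_zero_of_wDen H.q_lt H.t_ne H.b6_ne h1
  have hb := H.prod_eq ▸ one_ne_zero (α := ℂ)
  have hb2 : P.b2 ≠ 0 := fun h2 => hb (by simp [h2])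
  have hb3 : P.b3 ≠ 0 := fun h3 => hb (by simp [h3])
  have h3 : (specMinus P t).eval (α.point P t) = 0 := by
    rw [specMinus_eval]
    cases α <;> simp [Terminal.point, hb2, hb3]
  intro h
  apply h2
  rw [← h3, sub_eq_zero.mp h]

theorem eval_eq_divX {f : ℂ[X]} (h : f.coeff 0 = 0) (x : ℂ) : f.eval x = (divX f).eval x * x := by
  conv_lhs => rw [← divX_mul_X_add f, h]
  simp

theorem specV_eval (P : Param) {t : ℂ} (hq : ‖P.q‖ < 1) (x : ℂ) :
    2 * (P.q - 1) * x * (specV P t).eval x = (specPlus P t).eval x - (specMinus P t).eval x := by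
  have hq1 := q_sub_one_ne_zero hq
  have h := eval_eq_divX (f := specPlus P t - specMinus P t)
    (by simp [coeff_zero_eq_eval_zero, specPlus_eval, specMinus_eval]) x
  rw [← eval_sub, h, specV, eval_mul, eval_C]
  field_simp

section

variable {P : Param} {α β : Terminal} {t a0 : ℂ} {p : ℕ → ℂ[X]} {n : ℕ}
  {T11 T12 T21 T22 : ℂ[X]}

theorem IsTransfer.columns (H : IsAdmissible P α β t) (hp : IsOPS P α β t p) (ha0 : a0 ≠ 0)
    (hT : IsTransfer P α β t a0 p n T11 T12 T21 T22) {x : ℂ} (hx : x ∈ generic P α β t)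
    (j : Fin 2) :
    (specPlus P t).eval x * Ymat P α β t a0 p n (P.q * x) 0 j =
        T11.eval x * Ymat P α β t a0 p n x 0 j + T12.eval x * Ymat P α β t a0 p n x 1 j ∧
      (specPlus P t).eval x * Ymat P α β t a0 p n (P.q * x) 1 j =
        T21.eval x * Ymat P α β t a0 p n x 0 j + T22.eval x * Ymat P α β t a0 p n x 1 j := by
  obtain ⟨h0, h1, h2, hn, hd⟩ := hx
  have e11 := hT.eval_11 x h0 h1 h2
  have e12 := hT.eval_12 x h0 h1 h2
  have e21 := hT.eval_21 x h0 h1 h2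
  have e22 := hT.eval_22 x h0 h1 h2
  have hc := hp.casoratian H.q_lt ha0 n h0 h1
  have hA := specPlus_ne_zero_of_wDen H.q_lt H.t_ne H.b6_ne hd
  have hB := specMinus_ne_zero_of_wNum H.q_lt H.t_ne H.b6_ne hn
  have hw : weight P x t ≠ 0 := div_ne_zero hn hd
  have hs := weight_shift H.q_lt H.b6_ne H.t_ne hd
  have hw' : (weight P (P.q * x) t)⁻¹ =
      (specMinus P t).eval x * ((specPlus P t).eval x)⁻¹ * (weight P x t)⁻¹ := by
    have : weight P (P.q * x) t ≠ 0 := fun h => by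
      rw [h, zero_mul] at hs
      exact mul_ne_zero hw hA hs.symm
    field_simp
    linear_combination -hs
  fin_cases j
  · simp only [Ymat, Fin.mk_zero, Fin.isValue, Matrix.of_apply, Matrix.cons_val]
    constructor
    · linear_combination -(p n).eval x * e11 - polyPrev p n x * e12 -
        (specPlus P t).eval x * (p n).eval (P.q * x) * hc
    · linear_combination -(p n).eval x * e21 - polyPrev p n x * e22 -
        (specPlus P t).eval x * polyPrev p n (P.q * x) * hc
  · simp only [Ymat, Fin.mk_one, Fin.isValue, Matrix.of_apply, Matrix.cons_val, div_eq_mul_inv]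
    rw [hw']
    generalize weight P x t = w at *
    constructor
    · field_simp
      linear_combination -assoc P α β t p n x * e11 - assocPrev P α β t a0 p n x * e12 -
        (specMinus P t).eval x * assoc P α β t p n (P.q * x) * hc
    · field_simp
      linear_combination -assoc P α β t p n x * e21 - assocPrev P α β t a0 p n x * e22 -
        (specMinus P t).eval x * assocPrev P α β t a0 p n (P.q * x) * hc

theorem IsTransfer.det_eval (H : IsAdmissible P α β t) (hp : IsOPS P α β t p) (ha0 : a0 ≠ 0)
    (hT : IsTransfer P α β t a0 p n T11 T12 T21 T22) {x : ℂ} (hx : x ∈ generic P α β t) :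
    T11.eval x * T22.eval x - T12.eval x * T21.eval x =
      (specPlus P t).eval x * (specMinus P t).eval x := by
  obtain ⟨h0, h1, h2, -, -⟩ := hx
  have hc := hp.casoratian H.q_lt ha0 n h0 h1
  have hc' := hp.casoratian H.q_lt ha0 n (mul_ne_zero H.q_ne h0) h2
  rw [hT.eval_11 x h0 h1 h2, hT.eval_12 x h0 h1 h2, hT.eval_21 x h0 h1 h2,
    hT.eval_22 x h0 h1 h2]
  generalize recA a0 p n = a at *
  generalize (specPlus P t).eval x = A at *
  generalize (specMinus P t).eval x = B at *
  generalize (p n).eval x = y1 at *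
  generalize polyPrev p n x = y2 at *
  generalize assoc P α β t p n x = z1 at *
  generalize assocPrev P α β t a0 p n x = z2 at *
  generalize (p n).eval (P.q * x) = y1' at *
  generalize polyPrev p n (P.q * x) = y2' at *
  generalize assoc P α β t p n (P.q * x) = z1' at *
  generalize assocPrev P α β t a0 p n (P.q * x) = z2' at *
  linear_combination A * B * a * (y1' * z2' - y2' * z1') * hc + A * B * hc'

theorem Ymat_det_ne_zero (H : IsAdmissible P α β t) (hp : IsOPS P α β t p) (ha0 : a0 ≠ 0)
    {x : ℂ} (hx : x ∈ generic P α β t) :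
    Ymat P α β t a0 p n x 0 0 * Ymat P α β t a0 p n x 1 1 -
      Ymat P α β t a0 p n x 0 1 * Ymat P α β t a0 p n x 1 0 ≠ 0 := by
  obtain ⟨h0, h1, h2, hn, hd⟩ := hx
  have hc := hp.casoratian H.q_lt ha0 n h0 h1
  have hw : weight P x t ≠ 0 := div_ne_zero hn hd
  simp only [Ymat, Matrix.of_apply, Matrix.cons_val]
  intro h
  have : (p n).eval x * assocPrev P α β t a0 p n x - polyPrev p n x * assoc P α β t p n x = 0 := by
    field_simp at h
    linear_combination h
  rw [this] at hc
  simp at hc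

/-- The spectral coefficients read off from the transfer matrix. -/
def transferCoeffs (P : Param) (t a : ℂ) (T11 T12 T21 T22 : ℂ[X]) : SpectralCoeffs where
  W := C (1 / 4) * (specPlus P t + specMinus P t + T11 + T22)
  Om := C (1 / (2 * (P.q - 1))) * divX (T11 - T22) - specV P t
  Th := C (-1 / (a * (P.q - 1))) * divX T12
  ThPrev := C (1 / (a * (P.q - 1))) * divX T21

theorem isSpectral_iff (H : IsAdmissible P α β t) (S : SpectralCoeffs) :
    IsSpectral P α β t a0 p n S ↔ ∀ x ∈ generic P α β t, ∀ j,
      2 * S.W.eval x * (Ymat P α β t a0 p n (P.q * x) 0 j - Ymat P α β t a0 p n x 0 j) =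
        (P.q - 1) * x * (S.Om.eval x *
          (Ymat P α β t a0 p n (P.q * x) 0 j + Ymat P α β t a0 p n x 0 j) -
          recA a0 p n * S.Th.eval x *
          (Ymat P α β t a0 p n (P.q * x) 1 j + Ymat P α β t a0 p n x 1 j)) ∧
      2 * S.W.eval x * (Ymat P α β t a0 p n (P.q * x) 1 j - Ymat P α β t a0 p n x 1 j) =
        (P.q - 1) * x * (recA a0 p n * S.ThPrev.eval x *
          (Ymat P α β t a0 p n (P.q * x) 0 j + Ymat P α β t a0 p n x 0 j) -
          (S.Om.eval x + 2 * (specV P t).eval x) *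
          (Ymat P α β t a0 p n (P.q * x) 1 j + Ymat P α β t a0 p n x 1 j)) := by
  have hq1 := q_sub_one_ne_zero H.q_lt
  have key : ∀ x, x ≠ 0 → ((S.W.eval x • ddo P.q (Ymat P α β t a0 p n) x =
      S.mat P t (recA a0 p n) x * meanOp P.q (Ymat P α β t a0 p n) x) ↔ ∀ j,
      2 * S.W.eval x * (Ymat P α β t a0 p n (P.q * x) 0 j - Ymat P α β t a0 p n x 0 j) =
        (P.q - 1) * x * (S.Om.eval x *
          (Ymat P α β t a0 p n (P.q * x) 0 j + Ymat P α β t a0 p n x 0 j) -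
          recA a0 p n * S.Th.eval x *
          (Ymat P α β t a0 p n (P.q * x) 1 j + Ymat P α β t a0 p n x 1 j)) ∧
      2 * S.W.eval x * (Ymat P α β t a0 p n (P.q * x) 1 j - Ymat P α β t a0 p n x 1 j) =
        (P.q - 1) * x * (recA a0 p n * S.ThPrev.eval x *
          (Ymat P α β t a0 p n (P.q * x) 0 j + Ymat P α β t a0 p n x 0 j) -
          (S.Om.eval x + 2 * (specV P t).eval x) *
          (Ymat P α β t a0 p n (P.q * x) 1 j + Ymat P α β t a0 p n x 1 j))) := by
    intro x hx
    rw [← Matrix.ext_iff, Fin.forall_fin_two, ← forall_and]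
    refine forall_congr' fun j => ?_
    simp only [ddo, meanOp, SpectralCoeffs.mat, Matrix.mul_apply, Fin.sum_univ_two,
      Matrix.smul_apply, Matrix.sub_apply, Matrix.add_apply, smul_eq_mul, Matrix.of_apply,
      Matrix.cons_val]
    generalize Ymat P α β t a0 p n (P.q * x) 0 j = y0' at *
    generalize Ymat P α β t a0 p n (P.q * x) 1 j = y1' at *
    generalize Ymat P α β t a0 p n x 0 j = y0 at *
    generalize Ymat P α β t a0 p n x 1 j = y1 at *
    have hdx : (P.q - 1) * x ≠ 0 := mul_ne_zero hq1 hx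
    generalize (P.q - 1) * x = d at *
    constructor
    · rintro ⟨e1, e2⟩
      field_simp at e1 e2
      exact ⟨by linear_combination e1, by linear_combination e2⟩
    · rintro ⟨e1, e2⟩
      field_simp
      exact ⟨by linear_combination e1, by linear_combination e2⟩
  constructor
  · rintro h x ⟨h0, h1, h2, hn, hd⟩
    exact (key x h0).mp (h x h0 h1 h2 hn hd)
  · intro h x h0 h1 h2 hn hd
    exact (key x h0).mpr (h x ⟨h0, h1, h2, hn, hd⟩)

theorem transferCoeffs_eval (H : IsAdmissible P α β t) (hp : IsOPS P α β t p) (ha0 : a0 ≠ 0)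
    (hT : IsTransfer P α β t a0 p n T11 T12 T21 T22) (x : ℂ) :
    4 * (transferCoeffs P t (recA a0 p n) T11 T12 T21 T22).W.eval x =
      (specPlus P t).eval x + (specMinus P t).eval x + T11.eval x + T22.eval x ∧
    2 * (P.q - 1) * x * ((transferCoeffs P t (recA a0 p n) T11 T12 T21 T22).Om.eval x +
      (specV P t).eval x) = T11.eval x - T22.eval x ∧
    recA a0 p n * (P.q - 1) * x * (transferCoeffs P t (recA a0 p n) T11 T12 T21 T22).Th.eval x =
      -T12.eval x ∧
    recA a0 p n * (P.q - 1) * x *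
      (transferCoeffs P t (recA a0 p n) T11 T12 T21 T22).ThPrev.eval x = T21.eval x := by
  have hq1 := q_sub_one_ne_zero H.q_lt
  have ha := hp.recA_ne_zero ha0 n
  have h1 := eval_eq_divX (f := T11 - T22) (by simp [hT.coeff_zero_11, hT.coeff_zero_22]) x
  have h2 := eval_eq_divX hT.coeff_zero_12 x
  have h3 := eval_eq_divX hT.coeff_zero_21 x
  rw [eval_sub] at h1
  simp only [transferCoeffs, eval_mul, eval_C, eval_add, eval_sub]
  rw [h1, h2, h3]
  refine ⟨by ring, ?_, ?_, ?_⟩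
  · field_simp
    ring
  · field_simp
  · field_simp

theorem isSpectral_transferCoeffs (H : IsAdmissible P α β t) (hp : IsOPS P α β t p)
    (ha0 : a0 ≠ 0) (hT : IsTransfer P α β t a0 p n T11 T12 T21 T22) :
    IsSpectral P α β t a0 p n (transferCoeffs P t (recA a0 p n) T11 T12 T21 T22) := by
  rw [isSpectral_iff H]
  intro x hx j
  obtain ⟨e1, e2, e3, e4⟩ := transferCoeffs_eval H hp ha0 hT x
  obtain ⟨c1, c2⟩ := hT.columns H hp ha0 hx j
  have hdet := hT.det_eval H hp ha0 hx
  have hV := specV_eval P H.q_lt (t := t) x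
  have hA := specPlus_ne_zero_of_wDen H.q_lt H.t_ne H.b6_ne hx.2.2.2.2
  generalize transferCoeffs P t (recA a0 p n) T11 T12 T21 T22 = S at *
  generalize Ymat P α β t a0 p n (P.q * x) 0 j = y0' at *
  generalize Ymat P α β t a0 p n (P.q * x) 1 j = y1' at *
  generalize Ymat P α β t a0 p n x 0 j = y0 at *
  generalize Ymat P α β t a0 p n x 1 j = y1 at *
  generalize (specPlus P t).eval x = A at *
  generalize (specMinus P t).eval x = B at *
  generalize T11.eval x = τ1 at *
  generalize T12.eval x = τ2 at *
  generalize T21.eval x = τ3 at *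
  generalize T22.eval x = τ4 at *
  -- The adjugate of `T` applied to `A Y(qx) = T Y(x)`, with `det T = AB`, gives the inverse
  -- relation `adj(T) Y(qx) = B Y(x)`.
  have d1 : τ4 * y0' - τ2 * y1' = B * y0 := by
    apply mul_left_cancel₀ hA
    linear_combination τ4 * c1 - τ2 * c2 + y0 * hdet
  have d2 : τ1 * y1' - τ3 * y0' = B * y1 := by
    apply mul_left_cancel₀ hA
    linear_combination τ1 * c2 - τ3 * c1 + y1 * hdet
  constructor
  · linear_combination (1 / 2 : ℂ) * (y0' - y0) * e1 - (1 / 2 : ℂ) * (y0' + y0) * (e2 - hV) +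
      (y1' + y1) * e3 + c1 + d1
  · linear_combination (1 / 2 : ℂ) * (y1' - y1) * e1 + (1 / 2 : ℂ) * (y1' + y1) * (e2 + hV) -
      (y0' + y0) * e4 + c2 + d2

end

theorem eq_zero_of_columns {m₀ m₁ a b c d : ℂ} (hdet : a * d - b * c ≠ 0)
    (h₁ : m₀ * a + m₁ * c = 0) (h₂ : m₀ * b + m₁ * d = 0) : m₀ = 0 ∧ m₁ = 0 := by
  constructor
  · refine (mul_eq_zero.mp ?_).resolve_right hdet
    linear_combination d * h₁ - c * h₂
  · refine (mul_eq_zero.mp ?_).resolve_right hdet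
    linear_combination a * h₂ - b * h₁

/-- Inversion of the Cayley transform relating the spectral and the transfer matrix. -/
theorem cayley_entries {w N11 N12 N21 N22 A B T11 T12 T21 T22 : ℂ} (hA : A ≠ 0) (hAB : A - B ≠ 0)
    (hW : A + B + T11 + T22 ≠ 0) (hdet : T11 * T22 - T12 * T21 = A * B)
    (htr : N11 + N22 = B - A)
    (h1 : 2 * w * (T11 - A) - N11 * (T11 + A) - N12 * T21 = 0)
    (h2 : 2 * w * T12 - N11 * T12 - N12 * (T22 + A) = 0)
    (h3 : 2 * w * T21 - N21 * (T11 + A) - N22 * T21 = 0)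
    (h4 : 2 * w * (T22 - A) - N21 * T12 - N22 * (T22 + A) = 0) :
    4 * w = A + B + T11 + T22 ∧ 2 * N11 = T11 - T22 - A + B ∧ N12 = T12 ∧ N21 = T21 := by
  -- The hypotheses say `2w (T - A) = N (T + A)`. As `det (T + A) = A (A + B + tr T)`, multiplying
  -- by the adjugate of `T + A` solves for `N` up to the scale `w`.
  have e1 : N11 * (A + B + T11 + T22) = 2 * w * (B - A + T11 - T22) := by
    apply mul_left_cancel₀ hA
    linear_combination (2 * w - N11) * hdet - (T22 + A) * h1 + T21 * h2
  have e2 : N22 * (A + B + T11 + T22) = 2 * w * (B - A + T22 - T11) := by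
    apply mul_left_cancel₀ hA
    linear_combination (2 * w - N22) * hdet - (T11 + A) * h4 + T12 * h3
  have e3 : N12 * (A + B + T11 + T22) = 4 * w * T12 := by
    apply mul_left_cancel₀ hA
    linear_combination -N12 * hdet - (T11 + A) * h2 + T12 * h1
  have e4 : N21 * (A + B + T11 + T22) = 4 * w * T21 := by
    apply mul_left_cancel₀ hA
    linear_combination -N21 * hdet - (T22 + A) * h3 + T21 * h4
  -- The prescribed trace of `N` fixes the scale. This is where `A ≠ B` is essential.
  have e5 : 4 * w = A + B + T11 + T22 := by
    apply mul_left_cancel₀ hAB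
    linear_combination e1 + e2 - (A + B + T11 + T22) * htr
  refine ⟨e5, ?_, ?_, ?_⟩
  · apply mul_right_cancel₀ hW
    linear_combination 2 * e1 + (B - A + T11 - T22) * e5
  · apply mul_right_cancel₀ hW
    linear_combination e3 + T12 * e5
  · apply mul_right_cancel₀ hW
    linear_combination e4 + T21 * e5

theorem countable_setOf_eval_eq_zero {f : ℂ[X]} (hf : f ≠ 0) : {x | f.eval x = 0}.Countable :=
  (f.finite_setOfPred_isRoot hf).countable

section

variable {P : Param} {α β : Terminal} {t a0 : ℂ} {p : ℕ → ℂ[X]} {n : ℕ}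
  {T11 T12 T21 T22 : ℂ[X]}

theorem IsSpectral.eval_eq (H : IsAdmissible P α β t) (hp : IsOPS P α β t p)
    (ha0 : a0 ≠ 0) (hT : IsTransfer P α β t a0 p n T11 T12 T21 T22) {S : SpectralCoeffs}
    (hS : IsSpectral P α β t a0 p n S) {x : ℂ} (hx : x ∈ generic P α β t)
    (hx1 : (specPlus P t - specMinus P t).eval x ≠ 0)
    (hx2 : (specPlus P t + specMinus P t + T11 + T22).eval x ≠ 0) :
    4 * S.W.eval x =
      (specPlus P t).eval x + (specMinus P t).eval x + T11.eval x + T22.eval x ∧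
    2 * (P.q - 1) * x * (S.Om.eval x + (specV P t).eval x) = T11.eval x - T22.eval x ∧
    recA a0 p n * (P.q - 1) * x * S.Th.eval x = -T12.eval x ∧
    recA a0 p n * (P.q - 1) * x * S.ThPrev.eval x = T21.eval x := by
  have hS' := (isSpectral_iff H S).mp hS x hx
  obtain ⟨s1, s2⟩ := hS' 0
  obtain ⟨s3, s4⟩ := hS' 1
  obtain ⟨c1, c2⟩ := hT.columns H hp ha0 hx 0
  obtain ⟨c3, c4⟩ := hT.columns H hp ha0 hx 1
  have hY := Ymat_det_ne_zero (n := n) H hp ha0 hx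
  have hdet := hT.det_eval H hp ha0 hx
  have hV := specV_eval P H.q_lt (t := t) x
  have hA := specPlus_ne_zero_of_wDen H.q_lt H.t_ne H.b6_ne hx.2.2.2.2
  simp only [eval_add, eval_sub] at hx1 hx2
  generalize recA a0 p n = a at *
  generalize Ymat P α β t a0 p n (P.q * x) 0 0 = y0' at *
  generalize Ymat P α β t a0 p n (P.q * x) 1 0 = y1' at *
  generalize Ymat P α β t a0 p n (P.q * x) 0 1 = z0' at *
  generalize Ymat P α β t a0 p n (P.q * x) 1 1 = z1' at *
  generalize Ymat P α β t a0 p n x 0 0 = y0 at *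
  generalize Ymat P α β t a0 p n x 1 0 = y1 at *
  generalize Ymat P α β t a0 p n x 0 1 = z0 at *
  generalize Ymat P α β t a0 p n x 1 1 = z1 at *
  generalize (specPlus P t).eval x = A at *
  generalize (specMinus P t).eval x = B at *
  generalize T11.eval x = τ1 at *
  generalize T12.eval x = τ2 at *
  generalize T21.eval x = τ3 at *
  generalize T22.eval x = τ4 at *
  generalize S.W.eval x = w at *
  generalize S.Om.eval x = om at *
  generalize S.Th.eval x = th at *
  generalize S.ThPrev.eval x = th' at *
  generalize (specV P t).eval x = v at *
  set d := (P.q - 1) * x with hd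
  -- Each row of `2W_n (T - A) - N (T + A)` annihilates both columns of the invertible `Y_n(x)`,
  -- where `N` is `(q-1)x` times the spectral matrix.
  obtain ⟨h1, h2⟩ := eq_zero_of_columns (m₀ := 2 * w * (τ1 - A) - d * om * (τ1 + A) -
      -(d * a * th) * τ3) (m₁ := 2 * w * τ2 - d * om * τ2 - -(d * a * th) * (τ4 + A)) hY
    (by linear_combination A * s1 - 2 * w * c1 + d * om * c1 - d * a * th * c2)
    (by linear_combination A * s3 - 2 * w * c3 + d * om * c3 - d * a * th * c4)
  obtain ⟨h3, h4⟩ := eq_zero_of_columns (m₀ := 2 * w * τ3 - d * a * th' * (τ1 + A) -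
      -(d * (om + 2 * v)) * τ3) (m₁ := 2 * w * (τ4 - A) - d * a * th' * τ2 -
      -(d * (om + 2 * v)) * (τ4 + A)) hY
    (by linear_combination A * s2 - 2 * w * c2 + d * a * th' * c1 - d * (om + 2 * v) * c2)
    (by linear_combination A * s4 - 2 * w * c4 + d * a * th' * c3 - d * (om + 2 * v) * c4)
  obtain ⟨r1, r2, r3, r4⟩ := cayley_entries hA hx1 hx2 hdet
    (by rw [hd]; linear_combination -hV) h1 h2 h3 h4
  refine ⟨r1, ?_, ?_, ?_⟩
  · rw [hd] at r2
    linear_combination r2 + hV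
  · rw [hd] at r3
    linear_combination -r3
  · rw [hd] at r4
    linear_combination r4

theorem IsSpectral.eq_transferCoeffs (H : IsAdmissible P α β t) (hp : IsOPS P α β t p)
    (ha0 : a0 ≠ 0) (hT : IsTransfer P α β t a0 p n T11 T12 T21 T22) {S : SpectralCoeffs}
    (hS : IsSpectral P α β t a0 p n S) :
    S = transferCoeffs P t (recA a0 p n) T11 T12 T21 T22 := by
  have hq1 := q_sub_one_ne_zero H.q_lt
  have ha := hp.recA_ne_zero ha0 n
  -- Its value at the origin is `4 b₆t`.
  have hW : specPlus P t + specMinus P t + T11 + T22 ≠ 0 := by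
    intro h
    have h0 := congrArg (fun f => f.coeff 0) h
    simp only [coeff_add, hT.coeff_zero_11, hT.coeff_zero_22, coeff_zero] at h0
    rw [coeff_zero_eq_eval_zero, coeff_zero_eq_eval_zero, specPlus_eval, specMinus_eval] at h0
    have : P.b6 * t = 0 := by linear_combination (1 / 4 : ℂ) * h0
    exact mul_ne_zero H.b6_ne H.t_ne this
  have hZ := (countable_setOf_eval_eq_zero (specPlus_sub_specMinus_ne_zero H)).union
    (countable_setOf_eval_eq_zero hW)
  have key : ∀ x ∈ generic P α β t,
      x ∉ {x | (specPlus P t - specMinus P t).eval x = 0} ∪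
        {x | (specPlus P t + specMinus P t + T11 + T22).eval x = 0} →
      _ := fun x hx hxZ => hS.eval_eq H hp ha0 hT hx (fun h => hxZ (Or.inl h))
        (fun h => hxZ (Or.inr h))
  have e1 : S.W = (transferCoeffs P t (recA a0 p n) T11 T12 T21 T22).W := by
    refine eq_of_generic H.q_ne H.q_lt α β t hZ fun x hx hxZ => ?_
    have h := (key x hx hxZ).1
    have h' := (transferCoeffs_eval H hp ha0 hT x).1
    linear_combination (1 / 4 : ℂ) * (h - h')
  have e2 : S.Om = (transferCoeffs P t (recA a0 p n) T11 T12 T21 T22).Om := by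
    refine eq_of_generic H.q_ne H.q_lt α β t hZ fun x hx hxZ => ?_
    have h := (key x hx hxZ).2.1
    have h' := (transferCoeffs_eval H hp ha0 hT x).2.1
    apply mul_left_cancel₀ (mul_ne_zero (mul_ne_zero two_ne_zero hq1) hx.1)
    linear_combination h - h'
  have e3 : S.Th = (transferCoeffs P t (recA a0 p n) T11 T12 T21 T22).Th := by
    refine eq_of_generic H.q_ne H.q_lt α β t hZ fun x hx hxZ => ?_
    have h := (key x hx hxZ).2.2.1
    have h' := (transferCoeffs_eval H hp ha0 hT x).2.2.1
    apply mul_left_cancel₀ (mul_ne_zero (mul_ne_zero ha hq1) hx.1)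
    linear_combination h - h'
  have e4 : S.ThPrev = (transferCoeffs P t (recA a0 p n) T11 T12 T21 T22).ThPrev := by
    refine eq_of_generic H.q_ne H.q_lt α β t hZ fun x hx hxZ => ?_
    have h := (key x hx hxZ).2.2.2
    have h' := (transferCoeffs_eval H hp ha0 hT x).2.2.2
    apply mul_left_cancel₀ (mul_ne_zero (mul_ne_zero ha hq1) hx.1)
    linear_combination h - h'
  cases S
  simp only at e1 e2 e3 e4
  rw [e1, e2, e3, e4]

/-- The first column of the transfer relation reads `T₁₁ p_n = A p_n(qx) - T₁₂ p_{n-1}`. Since `T₁₂`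
is at most quadratic, the top degree comes from `A p_n(qx)` alone. -/
theorem IsTransfer.natDegree_11 (H : IsAdmissible P α β t) (hp : IsOPS P α β t p) (ha0 : a0 ≠ 0)
    (hT : IsTransfer P α β t a0 p n T11 T12 T21 T22) :
    T11.natDegree ≤ 3 ∧ T11.coeff 3 = P.q ^ n * (specPlus P t).coeff 3 := by
  set r : ℂ[X] := match n with
    | 0 => 0
    | m + 1 => p m with hr
  have hreval : ∀ x, polyPrev p n x = r.eval x := by
    intro x
    rw [hr]
    cases n <;> simp [polyPrev]
  have hrdeg : r.natDegree ≤ n := by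
    rw [hr]
    cases n with
    | zero => simp
    | succ m => exact (hp.natDegree_eq m).le.trans (Nat.le_succ m)
  have hpoly : T11 * p n = specPlus P t * (p n).comp (C P.q * X) - T12 * r := by
    refine eq_of_generic H.q_ne H.q_lt α β t Set.countable_empty fun x hx _ => ?_
    have h := (hT.columns H hp ha0 hx 0).1
    simp only [Ymat, Matrix.of_apply, Matrix.cons_val, hreval] at h
    simp only [eval_mul, eval_sub, eval_comp, eval_C, eval_X]
    linear_combination -h
  have hd1 : ((p n).comp (C P.q * X)).natDegree ≤ n :=
    (natDegree_comp_C_mul_X_le _ _).trans (hp.natDegree_eq n).le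
  have hd2 : (specPlus P t * (p n).comp (C P.q * X)).natDegree ≤ 3 + n :=
    natDegree_mul_le_of_le (natDegree_specPlus_le P t) hd1
  have hd3 : (T12 * r).natDegree ≤ 2 + n := natDegree_mul_le_of_le hT.natDegree_12 hrdeg
  have hpn : p n ≠ 0 := fun h => hp.gam_ne_zero n (by simp [gam, h])
  have hdeg : T11.natDegree ≤ 3 := by
    by_cases h0 : T11 = 0
    · simp [h0]
    · have h1 := natDegree_mul h0 hpn
      have h2 : (T11 * p n).natDegree ≤ 3 + n := by
        rw [hpoly]
        exact (natDegree_sub_le _ _).trans (max_le hd2 (hd3.trans (by omega)))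
      rw [h1, hp.natDegree_eq] at h2
      omega
  refine ⟨hdeg, ?_⟩
  have h := congrArg (fun f => f.coeff (3 + n)) hpoly
  simp only [coeff_sub] at h
  rw [coeff_mul_add_eq_of_natDegree_le hdeg (hp.natDegree_eq n).le,
    coeff_mul_add_eq_of_natDegree_le (natDegree_specPlus_le P t) hd1, comp_C_mul_X_coeff,
    coeff_eq_zero_of_natDegree_lt (hd3.trans_lt (by omega)), ← hp.gam_eq_coeff] at h
  apply mul_right_cancel₀ (hp.gam_ne_zero n)
  linear_combination h

end

/-! ### The evolution in time -/

/-- Decomposition of a polynomial orthogonal to all polynomials of degree less than `n - 1`. -/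
theorem IsOPS.exists_three_term {P : Param} {α β : Terminal} {t : ℂ} {p : ℕ → ℂ[X]}
    (hp : IsOPS P α β t p) (hq : ‖P.q‖ < 1) {m : ℕ} {g : ℂ[X]} (hg : g.natDegree ≤ m + 2)
    (horth : ∀ k < m, polyInt hq α β t (g * p k) = 0) :
    ∃ s0 : ℂ, g = (C (g.coeff (m + 2) / gam p (m + 1)) * X + C s0) * p (m + 1) +
      C (polyInt hq α β t (g * p m) -
        g.coeff (m + 2) / gam p (m + 1) * (gam p m / gam p (m + 1))) * p m := by
  set s1 := g.coeff (m + 2) / gam p (m + 1) with hs1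
  have hγ := hp.gam_ne_zero (m + 1)
  set g1 := g - C s1 * X * p (m + 1) with hg1
  have hg1d : g1.natDegree ≤ m + 1 := by
    rw [natDegree_le_iff_coeff_eq_zero]
    intro N hN
    rw [hg1, mul_assoc, coeff_sub, coeff_C_mul]
    obtain ⟨N, rfl⟩ : ∃ k, N = k + 1 := ⟨N - 1, by omega⟩
    rw [coeff_X_mul]
    rcases (show m + 1 ≤ N by omega).eq_or_lt with rfl | hN'
    · rw [← hp.gam_eq_coeff, hs1, div_mul_cancel₀ _ hγ, sub_self]
    · rw [coeff_eq_zero_of_natDegree_lt (hg.trans_lt (by omega)),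
        coeff_eq_zero_of_natDegree_lt ((hp.natDegree_eq _).trans_lt hN')]
      simp
  set s0 := g1.coeff (m + 1) / gam p (m + 1) with hs0
  refine ⟨s0, ?_⟩
  have hX : ∀ k ≤ m, polyInt hq α β t (p (m + 1) * (X * p k)) =
      (p k).coeff m / gam p (m + 1) := by
    intro k hk
    rw [hp.polyInt_mul_of_natDegree_le hq, coeff_X_mul]
    rw [natDegree_X_mul (fun h => hp.gam_ne_zero k (by simp [gam, h])), hp.natDegree_eq]
    omega
  have hint : ∀ k ≤ m, polyInt hq α β t ((g1 - C s0 * p (m + 1)) * p k) =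
      polyInt hq α β t (g * p k) - s1 * ((p k).coeff m / gam p (m + 1)) := by
    intro k hk
    rw [← hX k hk, ← polyInt_C_mul, ← map_sub, hg1,
      show (g - C s1 * X * p (m + 1) - C s0 * p (m + 1)) * p k =
        (g * p k - C s1 * (p (m + 1) * (X * p k))) - C s0 * (p (m + 1) * p k) by ring,
      map_sub, polyInt_C_mul _ _ _ _ s0, hp.polyInt_mul, if_neg (by omega)]
    ring
  -- The pairing of the remainder with `p m`, using `∫ x p_{m+1} p_m = γ_m/γ_{m+1}`.
  set s2 := polyInt hq α β t (g * p m) - s1 * (gam p m / gam p (m + 1)) with hs2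
  have h2 : g1 - C s0 * p (m + 1) - C s2 * p m = 0 := by
    refine hp.eq_zero_of_orthogonal hq (n := m + 1) ?_ ?_
    · refine (degree_sub_le _ _).trans_lt (max_lt (hp.degree_sub_lt hg1d) ?_)
      rw [degree_lt_iff_coeff_zero]
      intro N hN
      rw [coeff_C_mul, coeff_eq_zero_of_natDegree_lt (by rw [hp.natDegree_eq]; omega), mul_zero]
    · intro k hk
      rw [sub_mul, map_sub, hint k (by omega), mul_assoc, polyInt_C_mul, hp.polyInt_mul]
      rcases (show k ≤ m by omega).eq_or_lt with rfl | hk'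
      · rw [if_pos rfl, hs2, hp.gam_eq_coeff k]
        ring
      · rw [if_neg (by omega), horth k hk',
          coeff_eq_zero_of_natDegree_lt ((hp.natDegree_eq _).trans_lt hk')]
        ring
  rw [hg1] at h2
  linear_combination h2

/-- `∫ w(x;qt) b₆(qt - b₆x) f = ∫ w(x;t) (b₆qt - x) f` on polynomials. -/
theorem polyInt_time_shift {P : Param} {α β : Terminal} {t : ℂ} (H : IsAdmissible P α β t)
    (H' : IsAdmissible P α β (P.q * t)) (f : ℂ[X]) :
    polyInt H.q_lt α β (P.q * t) (C P.b6 * (C (P.q * t) - C P.b6 * X) * f) =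
      polyInt H.q_lt α β t ((C (P.b6 * (P.q * t)) - X) * f) := by
  have h := wInt_time_shift H.t_ne H' (fun y => f.eval y)
  rw [polyInt_apply, polyInt_apply]
  simpa only [eval_mul, eval_sub, eval_C, eval_X] using h

theorem cauchy_time_shift {P : Param} {α β : Terminal} {t : ℂ} (H : IsAdmissible P α β t)
    (H' : IsAdmissible P α β (P.q * t)) (v : ℂ[X]) (x : ℂ) :
    cauchy P α β (P.q * t) (C P.b6 * (C (P.q * t) - C P.b6 * X) * v) x =
      cauchy P α β t ((C (P.b6 * (P.q * t)) - X) * v) x := by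
  have h := wInt_time_shift H.t_ne H' (fun y => v.eval y / (x - y))
  unfold cauchy
  simpa only [eval_mul, eval_sub, eval_C, eval_X, mul_div_assoc] using h

/-- A relation between polynomials at two times induces one between their Cauchy transforms. -/
theorem mul_cauchy_of_time_relation {P : Param} {α β : Terminal} {t : ℂ}
    (H : IsAdmissible P α β t) (H' : IsAdmissible P α β (P.q * t)) {v u r : ℂ[X]} {s0 s1 s2 : ℂ}
    (h : C P.b6 * (C (P.q * t) - C P.b6 * X) * v = (C s1 * X + C s0) * u + C s2 * r)
    {x : ℂ} (hx : x ≠ 0) (hl : x ∉ lattice P α β t) (hl' : x ∉ lattice P α β (P.q * t)) :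
    (P.b6 * (P.q * t) - x) * cauchy P α β t v x =
      (s1 * x + s0) * cauchy P α β (P.q * t) u x + s2 * cauchy P α β (P.q * t) r x -
        s1 * polyInt H.q_lt α β (P.q * t) u - polyInt H.q_lt α β t v := by
  have h1 := cauchy_time_shift H H' v x
  rw [h, show (C s1 * X + C s0) * u + C s2 * r = (C s1 * (u * X) + C s0 * u) + C s2 * r by ring,
    show (C (P.b6 * (P.q * t)) - X) * v = C (P.b6 * (P.q * t)) * v + C (-1) * (v * X) by
      rw [C_neg, C_1]; ring,
    cauchy_add H.q_lt _ _ _ _ _ hx, cauchy_add H.q_lt _ _ _ _ _ hx,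
    cauchy_add H.q_lt _ _ _ _ _ hx] at h1
  simp only [cauchy_C_mul] at h1
  have h2 := mul_cauchy H.q_lt α β t v hx hl
  have h3 := mul_cauchy H.q_lt α β (P.q * t) u hx hl'
  linear_combination -h1 - h2 - s1 * h3

/-- The evolution of the orthogonal polynomials and their associated functions in time. -/
theorem exists_time_evolution {P : Param} {α β : Terminal} {t a0 : ℂ} {p p' : ℕ → ℂ[X]}
    (H : IsAdmissible P α β t) (H' : IsAdmissible P α β (P.q * t)) (hp : IsOPS P α β t p)
    (hp' : IsOPS P α β (P.q * t) p') (ha0 : a0 ≠ 0) (n : ℕ) :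
    ∃ s0 s1 s2 : ℂ, s1 = -(P.b6 ^ 2 * (gam p n / gam p' n)) ∧
      s2 = recA a0 p' n * (P.b6 ^ 2 * (gam p n / gam p' n) - gam p' n / gam p n) ∧
      (∀ x, P.b6 * (P.q * t - P.b6 * x) * (p n).eval x =
        (s1 * x + s0) * (p' n).eval x + s2 * polyPrev p' n x) ∧
      ∀ x, x ≠ 0 → x ∉ lattice P α β t → x ∉ lattice P α β (P.q * t) →
        (P.b6 * (P.q * t) - x) * assoc P α β t p n x =
          (s1 * x + s0) * assoc P α β (P.q * t) p' n x +
            s2 * assocPrev P α β (P.q * t) a0 p' n x := by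
  have hg := hp.gam_ne_zero n
  have hg' := hp'.gam_ne_zero n
  cases n with
  | zero =>
    have hc : p 0 = C (gam p 0) := by
      rw [hp.gam_eq_coeff]; exact eq_C_of_natDegree_eq_zero (hp.natDegree_eq 0)
    have hc' : p' 0 = C (gam p' 0) := by
      rw [hp'.gam_eq_coeff]; exact eq_C_of_natDegree_eq_zero (hp'.natDegree_eq 0)
    have hrel : C P.b6 * (C (P.q * t) - C P.b6 * X) * p 0 =
        (C (-(P.b6 ^ 2 * (gam p 0 / gam p' 0))) * X +
          C (P.b6 * (P.q * t) * (gam p 0 / gam p' 0))) * p' 0 + C 0 * 0 := by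
      have e : C (gam p 0) = C (gam p 0 / gam p' 0) * C (gam p' 0) := by
        rw [← C_mul, div_mul_cancel₀ _ hg']
      rw [hc, hc', e]
      simp only [map_neg, map_mul, map_pow]
      ring
    -- For `n = 0` the polynomial relation leaves `s₂` free, as `p̂_{-1} = 0`. In the associated
    -- relation the constant `-s₁/γ̂₀ - 1/γ₀` left by the Cauchy transforms is exactly `s₂ q̂_{-1}`.
    refine ⟨P.b6 * (P.q * t) * (gam p 0 / gam p' 0), _, _, rfl, rfl, fun x => ?_,
      fun x hx hl hl' => ?_⟩
    · have h := congrArg (fun f => f.eval x) hrel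
      simp only [eval_mul, eval_add, eval_sub, eval_C, eval_X, eval_zero] at h
      rw [h]
      simp [polyPrev]
    · have h := mul_cauchy_of_time_relation H H' hrel hx hl hl'
      have i1 : polyInt H.q_lt α β t (p 0) = 1 / gam p 0 := by
        have := hp.polyInt_mul_of_natDegree_le H.q_lt (n := 0) (f := 1) (by simp)
        simpa using this
      have i2 : polyInt H.q_lt α β (P.q * t) (p' 0) = 1 / gam p' 0 := by
        have := hp'.polyInt_mul_of_natDegree_le H.q_lt (n := 0) (f := 1) (by simp)
        simpa using this
      rw [i1, i2, zero_mul, add_zero] at h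
      change _ * cauchy P α β t (p 0) x = _ * cauchy P α β (P.q * t) (p' 0) x + _
      rw [h]
      simp only [recA, assocPrev]
      field_simp
      ring
  | succ m =>
    have hd : (C P.b6 * (C (P.q * t) - C P.b6 * X) * p (m + 1)).natDegree ≤ m + 2 := by
      rw [show m + 2 = 1 + (m + 1) by omega]
      refine natDegree_mul_le_of_le ?_ (hp.natDegree_eq _).le
      rw [show C P.b6 * (C (P.q * t) - C P.b6 * X) =
        C (-P.b6 ^ 2) * X + C (P.b6 * (P.q * t)) by
          simp only [map_neg, map_mul, map_pow]; ring]
      exact natDegree_linear_le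
    have hcoeff : (C P.b6 * (C (P.q * t) - C P.b6 * X) * p (m + 1)).coeff (m + 2) =
        -(P.b6 ^ 2 * gam p (m + 1)) := by
      rw [show C P.b6 * (C (P.q * t) - C P.b6 * X) * p (m + 1) =
        C (-P.b6 ^ 2) * (X * p (m + 1)) + C (P.b6 * (P.q * t)) * p (m + 1) by
          simp only [map_neg, map_mul, map_pow]; ring, coeff_add, coeff_C_mul, coeff_C_mul,
        coeff_X_mul, ← hp.gam_eq_coeff, coeff_eq_zero_of_natDegree_lt (n := m + 2)
          (by rw [hp.natDegree_eq]; omega)]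
      ring
    -- Passing to time `t` replaces the factor by `b₆qt - x`, and orthogonality of `p (m + 1)` keeps
    -- only the coefficient of `x^(m+1)`.
    have hint : ∀ k ≤ m, polyInt H.q_lt α β (P.q * t)
        (C P.b6 * (C (P.q * t) - C P.b6 * X) * p (m + 1) * p' k) =
        -((p' k).coeff m / gam p (m + 1)) := by
      intro k hk
      rw [mul_assoc, polyInt_time_shift H H', mul_left_comm, hp.polyInt_mul_of_natDegree_le,
        sub_mul, coeff_sub, coeff_C_mul, coeff_X_mul,
        coeff_eq_zero_of_natDegree_lt (by rw [hp'.natDegree_eq]; omega)]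
      · ring
      · rw [add_comm]
        refine natDegree_mul_le_of_le ?_ ((hp'.natDegree_eq _).le.trans hk)
        rw [show C (P.b6 * (P.q * t)) - X = C (-1) * X + C (P.b6 * (P.q * t)) by
          rw [C_neg, C_1]; ring]
        exact natDegree_linear_le
    obtain ⟨s0, hrel⟩ := hp'.exists_three_term H.q_lt hd (fun k hk => by
      rw [hint k hk.le, coeff_eq_zero_of_natDegree_lt (by rw [hp'.natDegree_eq]; omega), zero_div,
        neg_zero])
    rw [hcoeff, hint m le_rfl, ← hp'.gam_eq_coeff] at hrel
    refine ⟨s0, _, _, rfl, rfl, ?_⟩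
    have e1 : -(P.b6 ^ 2 * gam p (m + 1)) / gam p' (m + 1) =
      -(P.b6 ^ 2 * (gam p (m + 1) / gam p' (m + 1))) := by ring
    have e2 : -(gam p' m / gam p (m + 1)) - -(P.b6 ^ 2 * (gam p (m + 1) / gam p' (m + 1))) *
        (gam p' m / gam p' (m + 1)) = recA a0 p' (m + 1) *
          (P.b6 ^ 2 * (gam p (m + 1) / gam p' (m + 1)) - gam p' (m + 1) / gam p (m + 1)) := by
      rw [recA]
      field_simp
      ring
    rw [e1, e2] at hrel
    refine ⟨fun x => ?_, fun x hx hl hl' => ?_⟩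
    · have h := congrArg (fun f => f.eval x) hrel
      simp only [eval_mul, eval_add, eval_sub, eval_C, eval_X] at h
      exact h
    · have h := mul_cauchy_of_time_relation H H' hrel hx hl hl'
      have i1 : polyInt H.q_lt α β t (p (m + 1)) = 0 := by
        have := hp.polyInt_mul_of_natDegree_le H.q_lt (n := m + 1) (f := 1) (by simp)
        simpa [coeff_one] using this
      have i2 : polyInt H.q_lt α β (P.q * t) (p' (m + 1)) = 0 := by
        have := hp'.polyInt_mul_of_natDegree_le H.q_lt (n := m + 1) (f := 1) (by simp)
        simpa [coeff_one] using this
      rw [i1, i2, mul_zero, sub_zero, sub_zero] at h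
      exact h

/-- The polynomial form of the compatibility between spectral and time evolution. -/
theorem exists_compatibility {P : Param} {α β : Terminal} {t a0 : ℂ} {p p' : ℕ → ℂ[X]}
    (H : IsAdmissible P α β t) (H' : IsAdmissible P α β (P.q * t)) (hp : IsOPS P α β t p)
    (hp' : IsOPS P α β (P.q * t) p') (ha0 : a0 ≠ 0) {n : ℕ} {T11 T12 T21 T22 : ℂ[X]}
    (hT : IsTransfer P α β (P.q * t) a0 p' n T11 T12 T21 T22) :
    ∃ (s0 : ℂ) (K : ℂ[X]),
      (C (P.b6 * (P.q * t)) - X) * (C (P.q * t) - C P.b6 * X) * K =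
        (C (-(P.b6 ^ 2 * (gam p n / gam p' n))) * X + C s0) * T12 -
          C (recA a0 p' n * (P.b6 ^ 2 * (gam p n / gam p' n) - gam p' n / gam p n)) * T11 := by
  obtain ⟨s0, s1, s2, hs1, hs2, hpol, hass⟩ := exists_time_evolution H H' hp hp' ha0 n
  obtain ⟨Φ, hΦ⟩ := exists_bilinear_mixed H (p' n) (p n)
  -- Multiplying the mixed expression by `(b₆τ - x)(τ - b₆x)` completes its quadratic multipliers to
  -- `A` and `B` at time `τ`. The time evolution then replaces `p_n` and `q_n` by hatted functions,
  -- which assemble into `T̂₁₁` and `T̂₁₂`.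
  refine ⟨s0, C (-recA a0 p' n * P.b6) * Φ, ?_⟩
  rw [← hs1, ← hs2]
  refine eq_of_generic H.q_ne H.q_lt α β (P.q * t) (lattice_countable P α β t) fun x hx hl => ?_
  obtain ⟨h0, h1, h2, -, -⟩ := hx
  have e1 := hT.eval_11 x h0 h1 h2
  have e2 := hT.eval_12 x h0 h1 h2
  have e3 := hΦ x h0 hl h2
  have e4 := hpol x
  have e5 := hass x h0 hl h1
  simp only [specPlus_eval, specMinus_eval] at e1 e2
  change Φ.eval x = _ * assoc P α β t p n x - _ * assoc P α β (P.q * t) p' n (P.q * x) at e3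
  simp only [eval_mul, eval_add, eval_sub, eval_C, eval_X]
  rw [e1, e2, e3]
  generalize recA a0 p' n = a at *
  generalize assoc P α β t p n x = z at *
  generalize assoc P α β (P.q * t) p' n x = z' at *
  generalize assocPrev P α β (P.q * t) a0 p' n x = zp at *
  generalize assoc P α β (P.q * t) p' n (P.q * x) = zq at *
  generalize (p' n).eval (P.q * x) = yq at *
  generalize (p' n).eval x = y' at *
  generalize polyPrev p' n x = yp at *
  generalize (p n).eval x = y at *
  generalize P.q * t = τ at *
  linear_combination a * ((1 - P.b2 * x) * (1 - P.b3 * x) * (P.b6 * τ - x) * zq * e4 -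
    P.b6 * (1 - P.b1 * x) * (1 - P.b4 * x) * (τ - P.b6 * x) * yq * e5)

theorem exists_linear_of_quadratic_mul {b τ : ℂ} (hb : b ≠ 0) {K E : ℂ[X]}
    (hE : E.natDegree ≤ 3) (h : (C (b * τ) - X) * (C τ - C b * X) * K = E) :
    ∃ k1 k0 : ℂ, b * k1 = E.coeff 3 ∧ ∀ x, (b * τ - x) * (τ - b * x) * (k1 * x + k0) = E.eval x := by
  have hd1 : (C (b * τ) - X : ℂ[X]).natDegree = 1 := by
    rw [show C (b * τ) - X = C (-1) * X + C (b * τ) by rw [C_neg, C_1]; ring]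
    exact natDegree_linear (by norm_num)
  have hd2 : (C τ - C b * X : ℂ[X]).natDegree = 1 := by
    rw [show C τ - C b * X = C (-b) * X + C τ by rw [C_neg]; ring]
    exact natDegree_linear (neg_ne_zero.mpr hb)
  have hn1 : (C (b * τ) - X : ℂ[X]) ≠ 0 := fun h => by rw [h] at hd1; simp at hd1
  have hn2 : (C τ - C b * X : ℂ[X]) ≠ 0 := fun h => by rw [h] at hd2; simp at hd2
  have hK : K.natDegree ≤ 1 := by
    by_cases hK0 : K = 0
    · simp [hK0]
    · rw [← h, natDegree_mul (mul_ne_zero hn1 hn2) hK0, natDegree_mul hn1 hn2, hd1, hd2] at hE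
      omega
  obtain ⟨k1, k0, rfl⟩ := exists_eq_X_add_C_of_natDegree_le_one hK
  refine ⟨k1, k0, ?_, fun x => ?_⟩
  · rw [← h, show (C (b * τ) - X) * (C τ - C b * X) * (C k1 * X + C k0) =
      C (b * k1) * X ^ 3 + C (b * k0 - (τ + b ^ 2 * τ) * k1) * X ^ 2 +
        C (b * τ ^ 2 * k1 - (τ + b ^ 2 * τ) * k0) * X + C (b * τ ^ 2 * k0) by
      simp only [map_sub, map_add, map_mul, map_pow]; ring]
    simp only [coeff_add, coeff_C_mul, coeff_X_pow, coeff_X, coeff_C]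
    norm_num
  · rw [← h]
    simp

theorem existsUnique_eval_eq_zero_of_natDegree_le_one {f : ℂ[X]} (hd : f.natDegree ≤ 1)
    (h1 : f.coeff 1 ≠ 0) : ∃! x, f.eval x = 0 := by
  obtain ⟨a, b, rfl⟩ := exists_eq_X_add_C_of_natDegree_le_one hd
  simp only [coeff_add, coeff_C_mul, coeff_X_one, mul_one, coeff_C_succ, add_zero] at h1
  refine ⟨-b / a, ?_, fun x hx => ?_⟩
  · simp only [eval_add, eval_mul, eval_C, eval_X]
    field_simp
    ring
  · simp only [eval_add, eval_mul, eval_C, eval_X] at hx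
    field_simp
    linear_combination hx

/-! ### The spectral variables in terms of the transfer matrix -/

section

variable {P : Param} {α β : Terminal} {t a0 : ℂ} {p : ℕ → ℂ[X]} {n : ℕ}
  {T11 T12 T21 T22 : ℂ[X]}

/-- Evaluated at `λ` and read at `x³`, this single identity supplies both the numerator and the
denominator of `zPlus`. -/
theorem transferCoeffs_w_add_v (H : IsAdmissible P α β t) (hp : IsOPS P α β t p) (ha0 : a0 ≠ 0)
    (hT : IsTransfer P α β t a0 p n T11 T12 T21 T22) :
    (transferCoeffs P t (recA a0 p n) T11 T12 T21 T22).w P t + C (P.q - 1) *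
      ((transferCoeffs P t (recA a0 p n) T11 T12 T21 T22).v P t * X) = T11 := by
  refine Polynomial.funext fun x => ?_
  obtain ⟨e1, e2, -, -⟩ := transferCoeffs_eval H hp ha0 hT x
  simp only [SpectralCoeffs.w, SpectralCoeffs.v, specW, eval_add, eval_sub, eval_mul, eval_C,
    eval_X, eval_ofNat]
  linear_combination (1 / 2 : ℂ) * e1 + (1 / 2 : ℂ) * e2

theorem transferCoeffs_zPlus (H : IsAdmissible P α β t) (hp : IsOPS P α β t p) (ha0 : a0 ≠ 0)
    (hT : IsTransfer P α β t a0 p n T11 T12 T21 T22) {lam : ℂ} (hlam : lam ≠ 0) :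
    (transferCoeffs P t (recA a0 p n) T11 T12 T21 T22).zPlus P t lam =
      T11.eval lam / lam / T11.coeff 3 := by
  have h := transferCoeffs_w_add_v H hp ha0 hT
  have h1 := congrArg (fun f => f.eval lam) h
  have h2 := congrArg (fun f => f.coeff 3) h
  simp only [eval_add, eval_mul, eval_C, eval_X] at h1
  simp only [coeff_add, coeff_C_mul, coeff_mul_X] at h2
  rw [SpectralCoeffs.zPlus, SpectralCoeffs.kappaPlus, h2, ← h1]
  congr 1
  field_simp

theorem IsTransfer.coeff_three_11 (H : IsAdmissible P α β t) (hp : IsOPS P α β t p)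
    (ha0 : a0 ≠ 0) (hT : IsTransfer P α β t a0 p n T11 T12 T21 T22) {b5 : ℂ}
    (hb5 : P.q ^ n = b5 / (P.b1 * P.b4 * P.b6)) : T11.coeff 3 = -(b5 * P.b6) := by
  have hb := H.prod_eq ▸ one_ne_zero (α := ℂ)
  have h1 : P.b1 ≠ 0 := fun h => hb (by simp [h])
  have h4 : P.b4 ≠ 0 := fun h => hb (by simp [h])
  have h6 := H.b6_ne
  rw [(hT.natDegree_11 H hp ha0).2, hb5, coeff_three_specPlus]
  field_simp

/-- Using `b₁b₂b₃b₄ = 1`, this shows that `Θ_n` has degree exactly one when `q b₅² ≠ 1`. -/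
theorem IsTransfer.coeff_two_12_eq (H : IsAdmissible P α β t)
    (hT : IsTransfer P α β t a0 p n T11 T12 T21 T22) {b5 : ℂ} (hb50 : b5 ≠ 0)
    (hb5 : P.q ^ n = b5 / (P.b1 * P.b4 * P.b6)) :
    T12.coeff 2 = recA a0 p n * P.b6 * (b5 - 1 / (P.q * b5)) := by
  have hb := H.prod_eq ▸ one_ne_zero (α := ℂ)
  have h1 : P.b1 ≠ 0 := fun h => hb (by simp [h])
  have h4 : P.b4 ≠ 0 := fun h => hb (by simp [h])
  have h6 := H.b6_ne
  have hq0 := H.q_ne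
  rw [hT.coeff_two_12, pow_succ, inv_pow, hb5, coeff_three_specPlus, coeff_three_specMinus]
  field_simp
  linear_combination -recA a0 p n * H.prod_eq

end

end QE6

end

/-- The first-order q-difference equation for the leading coefficients of the deformed
big q-Jacobi orthogonal polynomials. The spectral coefficients `S` are those at time `qt`,
`lam` is `ĝ = g(qt)`, and `S.fRetarded P b5 (P.q * t) lam` is `f = f(t)`. -/
theorem mainTheorem6 (P : QE6.Param) (t : ℂ) (α β : QE6.Terminal) (hαβ : α ≠ β)
    (hq0 : P.q ≠ 0) (hq1 : ‖P.q‖ < 1) (ht : t ≠ 0)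
    (hb : P.b1 * P.b2 * P.b3 * P.b4 = 1) (hb6 : P.b6 ≠ 0)
    (hreg : ∀ τ ∈ ({t, P.q * t} : Set ℂ), ∀ κ ∈ ({α, β} : Set QE6.Terminal), ∀ s : ℕ,
      QE6.wDen P (κ.point P τ * P.q ^ s) τ ≠ 0)
    (p : ℂ → ℕ → Polynomial ℂ)
    (hp : ∀ τ ∈ ({t, P.q * t} : Set ℂ), QE6.IsOPS P α β τ (p τ))
    (a0 : ℂ) (ha0 : a0 ≠ 0) (n : ℕ)
    (b5 : ℂ) (hb5 : P.q ^ n = b5 / (P.b1 * P.b4 * P.b6)) (hb5q : P.q * b5 ^ 2 ≠ 1) :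
    (∃! S : QE6.SpectralCoeffs, QE6.IsSpectral P α β (P.q * t) a0 (p (P.q * t)) n S) ∧
    ∀ S : QE6.SpectralCoeffs, QE6.IsSpectral P α β (P.q * t) a0 (p (P.q * t)) n S →
      (∃! lam : ℂ, S.Th.eval lam = 0) ∧
      ∀ lam : ℂ, S.Th.eval lam = 0 →
        lam ≠ 0 → lam ≠ P.b6 * (P.q * t) → lam ≠ P.b6⁻¹ * (P.q * t) →
        ∀ f : ℂ, f = S.fRetarded P b5 (P.q * t) lam →
          f ≠ b5 * P.q * t → f ≠ b5⁻¹ * t →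
          (QE6.gam (p (P.q * t)) n / (P.b6 * QE6.gam (p t) n)) ^ 2 =
            (f - b5⁻¹ * t) / (f - b5 * P.q * t) := by
  have H : QE6.IsAdmissible P α β t := ⟨hq0, hq1, ht, hb, hb6,
    hreg t (by simp) α (by simp), hreg t (by simp) β (by simp)⟩
  have H' : QE6.IsAdmissible P α β (P.q * t) := ⟨hq0, hq1, mul_ne_zero hq0 ht, hb, hb6,
    hreg _ (by simp) α (by simp), hreg _ (by simp) β (by simp)⟩
  have hp1 := hp t (by simp)
  have hp2 := hp (P.q * t) (by simp)
  generalize p t = p₁ at *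
  generalize p (P.q * t) = p₂ at *
  have hb50 : b5 ≠ 0 := by
    intro h
    rw [h, zero_div] at hb5
    exact pow_ne_zero n hq0 hb5
  have hqm := QE6.q_sub_one_ne_zero hq1
  have ha := hp2.recA_ne_zero ha0 n
  obtain ⟨T11, T12, T21, T22, hT⟩ := QE6.exists_transfer H' hp2 ha0 n
  refine ⟨⟨_, QE6.isSpectral_transferCoeffs H' hp2 ha0 hT,
    fun S hS => hS.eq_transferCoeffs H' hp2 ha0 hT⟩, fun S hS => ?_⟩
  rw [hS.eq_transferCoeffs H' hp2 ha0 hT]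
  clear hS S
  have hc12 := hT.coeff_two_12_eq H' hb50 hb5
  have hc11 := hT.coeff_three_11 H' hp2 ha0 hb5
  have hθ : b5 - 1 / (P.q * b5) ≠ 0 := by
    intro h
    field_simp at h
    exact hb5q (by linear_combination h)
  constructor
  · apply QE6.existsUnique_eval_eq_zero_of_natDegree_le_one
    · refine (natDegree_C_mul_le _ _).trans ?_
      rw [natDegree_divX_eq_natDegree_tsub_one]
      have := hT.natDegree_12
      omega
    · rw [QE6.transferCoeffs, coeff_C_mul, coeff_divX, hc12]
      exact mul_ne_zero (div_ne_zero (by norm_num) (mul_ne_zero ha hqm))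
        (mul_ne_zero (mul_ne_zero ha hb6) hθ)
  · intro lam hlam hl0 hl1 hl2 f hf hf1 _
    have hT12 : T12.eval lam = 0 := by
      have h := (QE6.transferCoeffs_eval H' hp2 ha0 hT lam).2.2.1
      rw [hlam, mul_zero] at h
      linear_combination h
    rw [QE6.SpectralCoeffs.fRetarded, QE6.SpectralCoeffs.Z,
      QE6.transferCoeffs_zPlus H' hp2 ha0 hT hl0, hc11] at hf
    obtain ⟨s0, K, hK⟩ := QE6.exists_compatibility H H' hp1 hp2 ha0 hT
    have hg1 := hp1.gam_ne_zero n
    have hg2 := hp2.gam_ne_zero n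
    generalize QE6.gam p₁ n = γ at *
    generalize QE6.gam p₂ n = γ' at *
    generalize QE6.recA a0 p₂ n = a at *
    set s1 := -(P.b6 ^ 2 * (γ / γ')) with hs1
    set s2 := a * (P.b6 ^ 2 * (γ / γ') - γ' / γ) with hs2
    obtain ⟨k1, k0, hk1, hk⟩ := QE6.exists_linear_of_quadratic_mul hb6 (by
      refine (natDegree_sub_le _ _).trans (max_le ?_ ?_)
      · exact natDegree_mul_le_of_le (m := 1) (n := 2) natDegree_linear_le hT.natDegree_12
      · exact (natDegree_C_mul_le _ _).trans (hT.natDegree_11 H' hp2 ha0).1) hK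
    -- Three pieces of data on `k1 * x + k0`: the value at the origin, the value at `λ̂`, and the
    -- leading coefficient `hk1`. The unknown `s0` drops out because `T12` vanishes at `0` and at
    -- `λ̂`.
    have hk0 := hk 0
    have hkl := hk lam
    simp only [eval_sub, eval_mul, eval_add, eval_C, eval_X, ← coeff_zero_eq_eval_zero,
      hT.coeff_zero_11, hT.coeff_zero_12, hT12] at hk0 hkl
    rw [coeff_sub, add_mul, coeff_add, mul_assoc, coeff_C_mul, coeff_X_mul, coeff_C_mul,
      coeff_C_mul, hc12, hc11,
      coeff_eq_zero_of_natDegree_lt (hT.natDegree_12.trans_lt (by norm_num))] at hk1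
    have hd1 : lam - P.b6 * (P.q * t) ≠ 0 := sub_ne_zero.mpr hl1
    have hd2 : P.b6 * lam - P.q * t ≠ 0 := by
      intro h
      apply hl2
      field_simp
      linear_combination h
    have hqt : P.q * t ≠ 0 := mul_ne_zero hq0 ht
    have hk0' : k0 = -s2 / (P.q * t) := by
      field_simp
      apply mul_left_cancel₀ (mul_ne_zero hb6 hqt)
      linear_combination hk0
    have hk1' : k1 = s1 * a * (b5 - 1 / (P.q * b5)) + s2 * b5 := by
      apply mul_left_cancel₀ hb6
      linear_combination hk1
    have hZ : s2 * (f - b5 * (P.q * t)) = s1 * a * (b5 * (P.q * t) - b5⁻¹ * t) := by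
      -- Since `κ₊ = -b₅b₆`, the prefactor in `Z` cancels it and `f = -qt T₁₁(λ̂)/(λ̂(λ̂ -
      -- b₆qt)(b₆λ̂ - qt)) + 1/λ̂`.
      have hf' : f - b5 * (P.q * t) = -(P.q * t) * T11.eval lam /
          (lam * (lam - P.b6 * (P.q * t)) * (P.b6 * lam - P.q * t)) -
          b5 * (P.q * t) + 1 / lam := by
        rw [hf]
        field_simp
        ring
      have hT11 : s2 * T11.eval lam =
          -(lam - P.b6 * (P.q * t)) * (P.b6 * lam - P.q * t) * (k1 * lam + k0) := by
        linear_combination hkl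
      have e : s2 * (f - b5 * (P.q * t)) = -(P.q * t) * (s2 * T11.eval lam) /
          (lam * (lam - P.b6 * (P.q * t)) * (P.b6 * lam - P.q * t)) -
          s2 * b5 * (P.q * t) + s2 / lam := by
        rw [hf']
        ring
      rw [e, hT11, hk0', hk1']
      generalize lam - P.b6 * (P.q * t) = d1 at *
      generalize P.b6 * lam - P.q * t = d2 at *
      field_simp
      ring
    have hR : (f - b5 * (P.q * t)) * (P.b6 ^ 2 * γ ^ 2 - γ' ^ 2) =
        -(P.b6 ^ 2 * γ ^ 2 * (b5 * (P.q * t) - b5⁻¹ * t)) := by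
      -- Both `s1 * a` and `s2` contain the nonzero factor `a/(γγ')`. Removing it leaves a relation
      -- between `γ²` and `γ'²`.
      apply mul_left_cancel₀ (div_ne_zero ha (mul_ne_zero hg1 hg2))
      have e1 : s2 = a / (γ * γ') * (P.b6 ^ 2 * γ ^ 2 - γ' ^ 2) := by
        rw [hs2]
        field_simp
      have e2 : s1 * a = -(a / (γ * γ') * (P.b6 ^ 2 * γ ^ 2)) := by
        rw [hs1]
        field_simp
      rw [e1, e2] at hZ
      linear_combination hZ
    rw [div_pow, div_eq_div_iff (pow_ne_zero 2 (mul_ne_zero hb6 hg1)) (sub_ne_zero.mpr hf1)]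
    linear_combination -hR
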